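/- Let $F=(f,g):\mathbb{C}^2\to\mathbb{C}^2$ be a polynomial mapping and let $j^q(F):\mathbb{C}^2\to J^q(2)$, $a\mapsto\bigl(a,F(a),(\partial^\alpha f(a),\partial^\alpha g(a))_{1\le|\alpha|\le q}\bigr)$, be its $q$-jet extension. Let $S^1_k\subset J^1(2)$ be the set of $1$-jets of corank $k$. Let $S^2_1\subset J^2(2)$ be the set of $2$-jets $\sigma$ having a representative $G$ at a point $a$ (that is, $j^2(G)(a)=\sigma$) such that $j^1(G)(a)\in S^1_1$, $j^1(G)$ is transversal to $S^1_1$ at $a$, and the restriction of $d_aG$ to the tangent line at $a$ of the smooth curve $S^1_1(G)=j^1(G)^{-1}(S^1_1)$ has corank $1$ (i.e. vanishes). Assume that $F$ is generic, i.e. $F$ is proper, $j^1(F)$ is transversal to $S^1_1$ and to $S^1_2$, and $j^2(F)$ is transversal to $S^2_1$. Then $F$ has only two-folds and simple cusps as singularities: for every point $a\in\mathbb{C}^2$ at which $d_aF$ is not an isomorphism, the germ $F_a:(\mathbb{C}^2,a)\to(\mathbb{C}^2,F(a))$ is biholomorphically equivalent (by germs of biholomorphisms in the source and in the target) to the germ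 at the origin of $(x,y)\mapsto(x,y^2)$ (a two-fold) or of $(x,y)\mapsto(x,y^3+xy)$ (a simple cusp). -/

import Mathlib

open MvPolynomial Topology

noncomputable section

namespace PlaneMap

/-- The affine plane `ℂ²`. -/
abbrev Plane : Type := Fin 2 → ℂ

/-- A polynomial mapping `ℂ² → ℂ²`, given by its two components. -/
abbrev PolyPair : Type := Fin 2 → MvPolynomial (Fin 2) ℂ

/-- The function `ℂ² → ℂ²` defined by a pair of polynomials. -/
def toFun (F : PolyPair) : Plane → Plane := fun x i => eval x (F i)

/-- The multi-indices `α = (α₁, α₂)` with `1 ≤ |α| ≤ q`. -/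
abbrev DerivIndex (q : ℕ) : Type :=
  {α : Fin (q + 1) × Fin (q + 1) // 1 ≤ (α.1 : ℕ) + (α.2 : ℕ) ∧ (α.1 : ℕ) + (α.2 : ℕ) ≤ q}

/-- The space of `q`-jets of mappings `ℂ² → ℂ²`, in its standard coordinates: source point, target
point, and the values of the partial derivatives of orders `1, …, q` of both components. -/
abbrev Jet (q : ℕ) : Type := Plane × Plane × (Fin 2 → DerivIndex q → ℂ)

/-- The `q`-jet extension `x ↦ (x, F(x), (∂^α Fᵢ(x))_{i, 1 ≤ |α| ≤ q})`. -/
def jet (q : ℕ) (F : PolyPair) : Plane → Jet q := fun x =>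
  (x, toFun F x, fun i α => eval x ((pderiv 0)^[(α.1.1 : ℕ)] ((pderiv 1)^[(α.1.2 : ℕ)] (F i))))

/-- The tangent space at `p` of a complex submanifold `S` of a complex normed space: the span of
the limits of `cₙ • (sₙ - p)`, with `sₙ ∈ S` tending to `p` and `cₙ` complex scalars. (For a complex
submanifold these limits already form a linear subspace, the usual tangent space.) -/
def tangentSpaceAt {V : Type*} [NormedAddCommGroup V] [NormedSpace ℂ V] (S : Set V) (p : V) :
    Submodule ℂ V :=
  Submodule.span ℂ (tangentConeAt ℂ S p)

/-- The holomorphic map `h` is transversal to the submanifold `S` at the point `x`: either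
`h x ∉ S`, or the image of the derivative and the tangent space of `S` span the ambient space. -/
def TransversalAt {E V : Type*} [NormedAddCommGroup E] [NormedSpace ℂ E]
    [NormedAddCommGroup V] [NormedSpace ℂ V] (h : E → V) (S : Set V) (x : E) : Prop :=
  h x ∈ S → LinearMap.range (fderiv ℂ h x).toLinearMap ⊔ tangentSpaceAt S (h x) = ⊤

/-- `h ⋔ S`. -/
def Transversal {E V : Type*} [NormedAddCommGroup E] [NormedSpace ℂ E]
    [NormedAddCommGroup V] [NormedSpace ℂ V] (h : E → V) (S : Set V) : Prop :=
  ∀ x, TransversalAt h S x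

/-- The differential `d_a F`. -/
def differential (F : PolyPair) (a : Plane) : Plane →ₗ[ℂ] Plane :=
  (fderiv ℂ (toFun F) a).toLinearMap

/-- The corank of a linear map whose source has dimension at most that of its target, that is,
the dimension of the source minus the rank. -/
def corank {V W : Type*} [AddCommGroup V] [Module ℂ V] [AddCommGroup W] [Module ℂ W]
    (L : V →ₗ[ℂ] W) : ℕ :=
  Module.finrank ℂ (LinearMap.ker L)

/-- `S^1_k`: the `1`-jets of corank `k`. -/
def corankStratum (k : ℕ) : Set (Jet 1) :=
  {σ | ∃ (F : PolyPair) (a : Plane), jet 1 F a = σ ∧ corank (differential F a) = k}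

/-- `S^1_1(F)`, the preimage of `S^1_1` under the `1`-jet extension of `F`. -/
def corankOneLocus (F : PolyPair) : Set Plane := jet 1 F ⁻¹' corankStratum 1

/-- `S^2_1`: the `2`-jets `σ` such that a representative `F` of `σ` at `a` has `1`-jet in `S^1_1`,
`j^1 F` is transversal to `S^1_1` at `a` (so that the locus `S^1_1(F)` is smooth at `a`), and the
restriction of `d_a F` to the tangent space of `S^1_1(F)` has corank `1`. -/
def secondStratum : Set (Jet 2) :=
  {σ | ∃ (F : PolyPair) (a : Plane), jet 2 F a = σ ∧
    jet 1 F a ∈ corankStratum 1 ∧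
    TransversalAt (jet 1 F) (corankStratum 1) a ∧
    corank ((differential F a).domRestrict (tangentSpaceAt (corankOneLocus F) a)) = 1}

/-- Generic polynomial mappings of the plane. -/
structure IsGeneric (F : PolyPair) : Prop where
  proper : IsProperMap (toFun F)
  transversal_corank_one : Transversal (jet 1 F) (corankStratum 1)
  transversal_second : Transversal (jet 2 F) secondStratum
  transversal_corank_two : Transversal (jet 1 F) (corankStratum 2)

/-- `a` is a singular (critical) point of `F`: the differential `d_a F` is not an isomorphism. -/
def IsSingularPoint (F : PolyPair) (a : Plane) : Prop :=
  ¬ Function.Bijective (differential F a)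

/-- `Φ` is a biholomorphism between its (open) source and its (open) target. -/
def IsBiholomorphism (Φ : OpenPartialHomeomorph Plane Plane) : Prop :=
  DifferentiableOn ℂ Φ Φ.source ∧ DifferentiableOn ℂ Φ.symm Φ.target

/-- The germs `F : (ℂ², a) → (ℂ², F(a))` and `G : (ℂ², b) → (ℂ², G(b))` are biholomorphically
equivalent: `Ψ ∘ F = G ∘ Φ` near `a` for germs of biholomorphisms
`Φ : (ℂ², a) → (ℂ², b)` and `Ψ : (ℂ², F(a)) → (ℂ², G(b))`. -/
def GermEquiv (F : Plane → Plane) (a : Plane) (G : Plane → Plane) (b : Plane) : Prop :=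
  ∃ Φ Ψ : OpenPartialHomeomorph Plane Plane,
    IsBiholomorphism Φ ∧ IsBiholomorphism Ψ ∧
    a ∈ Φ.source ∧ F a ∈ Ψ.source ∧ Φ a = b ∧ Ψ (F a) = G b ∧
    ∀ᶠ x in 𝓝 a, Ψ (F x) = G (Φ x)

/-- `F` has a two-fold at `a`: its germ is equivalent to `(x, y) ↦ (x, y²)` at the origin. -/
def IsTwoFold (F : Plane → Plane) (a : Plane) : Prop :=
  GermEquiv F a (fun z => ![z 0, z 1 ^ 2]) 0

/-- `F` has a simple cusp at `a`: its germ is equivalent to `(x, y) ↦ (x, y³ + xy)` at the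
origin. -/
def IsSimpleCusp (F : Plane → Plane) (a : Plane) : Prop :=
  GermEquiv F a (fun z => ![z 0, z 1 ^ 3 + z 0 * z 1]) 0

end PlaneMap

end

namespace PlaneMap

theorem isBiholomorphism_symm {Φ : OpenPartialHomeomorph Plane Plane} (h : IsBiholomorphism Φ) :
    IsBiholomorphism Φ.symm := by
  refine ⟨h.2, ?_⟩
  rw [OpenPartialHomeomorph.symm_symm]
  exact h.1

/-- A linear endomorphism of a finite-dimensional space with trivial kernel, as an
equivalence. -/
theorem exists_equiv_of_ker_trivial {ι : Type*} [Fintype ι] (L : (ι → ℂ) →L[ℂ] (ι → ℂ))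
    (h : ∀ v, L v = 0 → v = 0) :
    ∃ e : (ι → ℂ) ≃L[ℂ] (ι → ℂ), (e : (ι → ℂ) →L[ℂ] (ι → ℂ)) = L := by
  have hinj : Function.Injective L.toLinearMap := by
    rw [← LinearMap.ker_eq_bot, LinearMap.ker_eq_bot']
    exact h
  refine ⟨(LinearEquiv.ofInjectiveEndo L.toLinearMap hinj).toContinuousLinearEquiv, ?_⟩
  ext v
  rfl

/-- The inverse function theorem for maps of the plane, with biholomorphisms. -/
theorem exists_biholomorphism {φ : Plane → Plane} {b : Plane} {L : Plane →L[ℂ] Plane}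
    (hφ : ContDiffAt ℂ 1 φ b) (hL : HasFDerivAt φ L b) (h : ∀ v, L v = 0 → v = 0) :
    ∃ Φ : OpenPartialHomeomorph Plane Plane,
      IsBiholomorphism Φ ∧ b ∈ Φ.source ∧ ⇑Φ = φ := by
  obtain ⟨e, rfl⟩ := exists_equiv_of_ker_trivial L h
  let R := hφ.toOpenPartialHomeomorph φ hL one_ne_zero
  have hR : ⇑R = φ := rfl
  have hb : b ∈ R.source := hφ.mem_toOpenPartialHomeomorph_source hL one_ne_zero
  have hs : ContDiffAt ℂ 1 R.symm (φ b) := hφ.to_localInverse hL one_ne_zero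
  have ev : ∀ {f : Plane → Plane} {x : Plane}, ContDiffAt ℂ 1 f x →
      ∃ U, IsOpen U ∧ x ∈ U ∧ DifferentiableOn ℂ f U := by
    intro f x hf
    have := hf.eventually (by simp)
    obtain ⟨U, hU, hUo, hx⟩ := eventually_nhds_iff.1 this
    exact ⟨U, hUo, hx, fun y hy => ((hU y hy).differentiableAt one_ne_zero).differentiableWithinAt⟩
  obtain ⟨U, hUo, hbU, hU⟩ := ev hφ
  obtain ⟨V, hVo, hbV, hV⟩ := ev hs
  let R' := (R.symm.restrOpen V hVo).symm.restrOpen U hUo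
  refine ⟨R', ⟨?_, ?_⟩, ?_, rfl⟩
  · refine hU.mono ?_
    intro x hx
    simp only [R', OpenPartialHomeomorph.restrOpen_source] at hx
    exact hx.2
  · refine hV.mono ?_
    intro x hx
    have : x ∈ (R.symm.restrOpen V hVo).symm.target :=
      (OpenPartialHomeomorph.map_target R' hx |> fun h => hx.1)
    simp only [OpenPartialHomeomorph.symm_target, OpenPartialHomeomorph.restrOpen_source] at this
    exact this.2
  · simp only [R', OpenPartialHomeomorph.restrOpen_source]
    refine ⟨?_, hbU⟩
    simp only [OpenPartialHomeomorph.symm_source]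
    have h1 : φ b ∈ (R.symm.restrOpen V hVo).source := by
      simp only [OpenPartialHomeomorph.restrOpen_source]
      exact ⟨R.map_source hb, hbV⟩
    have := (R.symm.restrOpen V hVo).map_source h1
    have h2 : (R.symm.restrOpen V hVo) (φ b) = b := R.left_inv hb
    rwa [h2] at this

/-- A germ that becomes `κ` in suitable local parameters `φ`, `ψ` of source and target. -/
structure IsParametrizedBy (F : Plane → Plane) (a : Plane) (κ φ ψ : Plane → Plane) : Prop where
  contDiff_source : ContDiffAt ℂ 1 φ 0
  contDiff_target : ContDiffAt ℂ 1 ψ 0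
  map_source : φ 0 = a
  ker_source : ∀ v, fderiv ℂ φ 0 v = 0 → v = 0
  ker_target : ∀ v, fderiv ℂ ψ 0 v = 0 → v = 0
  comm : ∀ᶠ z in 𝓝 0, F (φ z) = ψ (κ z)

theorem IsParametrizedBy.germEquiv {F : Plane → Plane} {a : Plane} {κ φ ψ : Plane → Plane}
    (h : IsParametrizedBy F a κ φ ψ) (hκ : ContinuousAt κ 0) (hκ0 : κ 0 = 0) :
    GermEquiv F a κ 0 := by
  obtain ⟨Φ, hΦ, h0Φ, rfl⟩ := exists_biholomorphism h.contDiff_source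
    (h.contDiff_source.differentiableAt one_ne_zero).hasFDerivAt h.ker_source
  obtain ⟨Ψ, hΨ, h0Ψ, rfl⟩ := exists_biholomorphism h.contDiff_target
    (h.contDiff_target.differentiableAt one_ne_zero).hasFDerivAt h.ker_target
  have hF : F a = Ψ 0 := by
    have := h.comm.self_of_nhds
    rwa [h.map_source, hκ0] at this
  have ha : a ∈ Φ.target := h.map_source ▸ Φ.map_source h0Φ
  have hsa : Φ.symm a = 0 := by rw [← h.map_source, Φ.left_inv h0Φ]
  refine ⟨Φ.symm, Ψ.symm, isBiholomorphism_symm hΦ, isBiholomorphism_symm hΨ, ha, ?_, hsa, ?_, ?_⟩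
  · rw [hF]; exact Ψ.map_source h0Ψ
  · rw [hF, hκ0, Ψ.left_inv h0Ψ]
  · have hc : Filter.Tendsto Φ.symm (𝓝 a) (𝓝 0) := by
      have := Φ.continuousAt_symm ha
      rwa [ContinuousAt, hsa] at this
    have hk : ∀ᶠ z in 𝓝 (0 : Plane), κ z ∈ Ψ.source := by
      apply hκ.eventually_mem
      rw [hκ0]
      exact Ψ.open_source.mem_nhds h0Ψ
    filter_upwards [hc.eventually h.comm, hc.eventually hk, Φ.open_target.mem_nhds ha]
      with x hx hx' hxt
    rw [Φ.right_inv hxt] at hx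
    rw [hx, Ψ.left_inv hx']

/-- Changing the germ by local parameters of source and target. -/
theorem IsParametrizedBy.comp {F G : Plane → Plane} {a b : Plane} {κ φ ψ s T : Plane → Plane}
    (h : IsParametrizedBy G b κ φ ψ)
    (hs : ContDiff ℂ 1 s) (hT : ContDiff ℂ 1 T)
    (hsa : s b = a) (hs' : ∀ v, fderiv ℂ s b v = 0 → v = 0)
    (hT' : ∀ v, fderiv ℂ T (ψ 0) v = 0 → v = 0) (hc : ∀ z, F (s z) = T (G z)) :
    IsParametrizedBy F a κ (s ∘ φ) (T ∘ ψ) where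
  contDiff_source := hs.contDiffAt.comp _ h.contDiff_source
  contDiff_target := hT.contDiffAt.comp _ h.contDiff_target
  map_source := by simp [h.map_source, hsa]
  ker_source v hv := by
    rw [fderiv_comp _ (hs.differentiable one_ne_zero _)
      (h.contDiff_source.differentiableAt one_ne_zero), h.map_source] at hv
    exact h.ker_source v (hs' _ hv)
  ker_target v hv := by
    rw [fderiv_comp _ (hT.differentiable one_ne_zero _)
      (h.contDiff_target.differentiableAt one_ne_zero)] at hv
    exact h.ker_target v (hT' _ hv)
  comm := by
    filter_upwards [h.comm] with z hz
    simp [hc, hz]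

/-- The tangent space of a subset of a zero locus lies in the kernel of the derivative. -/
theorem tangentSpaceAt_le_ker {V W : Type*} [NormedAddCommGroup V] [NormedSpace ℂ V]
    [NormedAddCommGroup W] [NormedSpace ℂ W] {S : Set V} {p : V} {Φ : V → W} {L : V →L[ℂ] W}
    (hL : HasFDerivAt Φ L p) (hS : ∀ x ∈ S, Φ x = 0) :
    tangentSpaceAt S p ≤ LinearMap.ker L.toLinearMap := by
  refine Submodule.span_le.2 fun v hv => ?_
  have h1 := (hL.hasFDerivWithinAt (s := S)).mapsTo_tangent_cone hv
  have h2 : Φ '' S ⊆ {0} := by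
    rintro _ ⟨x, hx, rfl⟩
    exact hS x hx
  have h3 := tangentConeAt_mono h2 h1
  have h4 := tangentConeAt_subset_zero (𝕜 := ℂ) (x := Φ p) (s := {(0 : W)})
    (fun h => by
      rw [accPt_iff_nhds] at h
      by_cases hp : Φ p = 0
      · obtain ⟨y, hy, hne⟩ := h Set.univ Filter.univ_mem
        exact hne (hy.2.trans hp.symm)
      · obtain ⟨y, hy, -⟩ := h {0}ᶜ (isOpen_compl_singleton.mem_nhds hp)
        exact hy.1 hy.2) h3
  exact h4

/-- If `h` is transversal at `x` to a subset of `{Φ = 0}`, where `Φ` is a submersion at `h x`,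
then `Φ ∘ h` is a submersion at `x`. -/
theorem TransversalAt.surjective_comp {E V W : Type*} [NormedAddCommGroup E] [NormedSpace ℂ E]
    [NormedAddCommGroup V] [NormedSpace ℂ V] [NormedAddCommGroup W] [NormedSpace ℂ W]
    {h : E → V} {S : Set V} {x : E} (ht : TransversalAt h S x) (hx : h x ∈ S)
    (hh : DifferentiableAt ℂ h x) {Φ : V → W} {L : V →L[ℂ] W} (hL : HasFDerivAt Φ L (h x))
    (hS : ∀ x ∈ S, Φ x = 0) (hsurj : Function.Surjective L) {M : E →L[ℂ] W}
    (hM : HasFDerivAt (Φ ∘ h) M x) : Function.Surjective M := by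
  intro w
  obtain ⟨v, rfl⟩ := hsurj w
  have hv : v ∈ LinearMap.range (fderiv ℂ h x).toLinearMap ⊔ tangentSpaceAt S (h x) := by
    rw [ht hx]; trivial
  obtain ⟨_, ⟨u, rfl⟩, t, htt, rfl⟩ := Submodule.mem_sup.1 hv
  have h0 : L t = 0 := tangentSpaceAt_le_ker hL hS htt
  refine ⟨u, ?_⟩
  rw [hM.unique (hL.comp x hh.hasFDerivAt)]
  simp [h0]

/-- A regular zero locus of a function on the plane has nonzero tangent vectors. -/
theorem tangentSpaceAt_ne_bot {Φ : Plane → ℂ} {a : Plane} {L : Plane →L[ℂ] ℂ} {S : Set Plane}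
    (hΦ : HasStrictFDerivAt Φ L a) (hL : L ≠ 0) (h0 : Φ a = 0)
    (hS : ∀ᶠ x in 𝓝 a, Φ x = 0 → x ∈ S) : tangentSpaceAt S a ≠ ⊥ := by
  have hr : L.range = ⊤ := by
    apply LinearMap.range_eq_top.2
    apply LinearMap.surjective
    intro h
    exact hL (ContinuousLinearMap.coe_injective h)
  let c := hΦ.implicitFunction Φ L hr (Φ a)
  have hc : HasStrictFDerivAt c L.ker.subtypeL 0 := hΦ.to_implicitFunction hr
  have hca : c 0 = a := hΦ.implicitFunction_apply_image hr
  have hev : ∀ᶠ t in 𝓝 (0 : L.ker), c t ∈ S := by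
    have h1 := hΦ.map_implicitFunction_eq hr
    rw [nhds_prod_eq] at h1
    have h2 := h1.curry.self_of_nhds
    have h3 : ∀ᶠ t in 𝓝 (0 : L.ker), Φ (c t) = 0 → c t ∈ S :=
      (hca ▸ hc.continuousAt : Filter.Tendsto c (𝓝 0) (𝓝 a)).eventually hS
    filter_upwards [h2, h3] with t ht ht'
    exact ht' (ht.trans h0)
  have hker : LinearMap.ker L.toLinearMap ≠ ⊥ :=
    LinearMap.ker_ne_bot_of_finrank_lt (by simp)
  obtain ⟨u, hu, hu0⟩ := Submodule.exists_mem_ne_zero_of_ne_bot hker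
  have hcone : u ∈ tangentConeAt ℂ S a := by
    have h1 := (hc.hasFDerivAt.hasFDerivWithinAt (s := {t | c t ∈ S})).mapsTo_tangent_cone
      (show (⟨u, hu⟩ : L.ker) ∈ tangentConeAt ℂ {t | c t ∈ S} 0 by
        rw [tangentConeAt_of_mem_nhds hev]; trivial)
    rw [hca] at h1
    refine tangentConeAt_mono ?_ h1
    rintro _ ⟨t, ht, rfl⟩
    exact ht
  intro hbot
  have : u ∈ tangentSpaceAt S a := Submodule.subset_span hcone
  rw [hbot] at this
  exact hu0 ((Submodule.mem_bot ℂ).1 this)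

/-- The coefficient of `x ^ m * y ^ n`. -/
noncomputable def cf (f : MvPolynomial (Fin 2) ℂ) (m n : ℕ) : ℂ :=
  coeff (Finsupp.single 0 m + Finsupp.single 1 n) f

theorem cf_add (f g : MvPolynomial (Fin 2) ℂ) (m n : ℕ) : cf (f + g) m n = cf f m n + cf g m n :=
  coeff_add _ _ _

theorem cf_C (c : ℂ) (m n : ℕ) : cf (C c) m n = if m = 0 ∧ n = 0 then c else 0 := by
  unfold cf
  rw [coeff_C]
  congr 1
  apply propext
  rw [eq_comm, Finsupp.ext_iff]
  simp [Fin.forall_fin_two]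

theorem cf_mul_X_zero_zero (f : MvPolynomial (Fin 2) ℂ) (n : ℕ) : cf (f * X 0) 0 n = 0 := by
  unfold cf
  rw [coeff_mul_X', if_neg (by simp)]

theorem cf_mul_X_zero_succ (f : MvPolynomial (Fin 2) ℂ) (m n : ℕ) :
    cf (f * X 0) (m + 1) n = cf f m n := by
  unfold cf
  rw [Finsupp.single_add, add_right_comm, coeff_mul_X]

theorem cf_mul_X_one_zero (f : MvPolynomial (Fin 2) ℂ) (m : ℕ) : cf (f * X 1) m 0 = 0 := by
  unfold cf
  rw [coeff_mul_X', if_neg (by simp)]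

theorem cf_mul_X_one_succ (f : MvPolynomial (Fin 2) ℂ) (m n : ℕ) :
    cf (f * X 1) m (n + 1) = cf f m n := by
  unfold cf
  rw [Finsupp.single_add, ← add_assoc, coeff_mul_X]

theorem constantCoeff_eq_cf (f : MvPolynomial (Fin 2) ℂ) : constantCoeff f = cf f 0 0 := by
  simp [cf, constantCoeff_eq]

theorem cf_pderiv_zero (f : MvPolynomial (Fin 2) ℂ) (m n : ℕ) :
    cf (pderiv 0 f) m n = cf f (m + 1) n * (m + 1) := by
  simp only [cf, coeff_pderiv, Finsupp.single_add, add_right_comm]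
  simp

theorem cf_pderiv_one (f : MvPolynomial (Fin 2) ℂ) (m n : ℕ) :
    cf (pderiv 1 f) m n = cf f m (n + 1) * (n + 1) := by
  simp only [cf, coeff_pderiv, Finsupp.single_add, add_assoc]
  simp

/-- Reduction of `f (p₀ + p₁ Y, q + Y)` modulo `Y ^ 2 - Z`, as functions of
`t = (p₀, p₁, q, Z)`, with its first-order expansion at `t = 0`. -/
theorem exists_reduction_quadratic (f : MvPolynomial (Fin 2) ℂ) :
    ∃ r : Fin 2 → (Fin 4 → ℂ) → ℂ, (∀ j, ContDiff ℂ 1 (r j)) ∧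
      (∀ (t : Fin 4 → ℂ) (Y : ℂ), Y ^ 2 = t 3 →
        eval ![t 0 + t 1 * Y, t 2 + Y] f = r 0 t + r 1 t * Y) ∧
      r 0 0 = cf f 0 0 ∧ r 1 0 = cf f 0 1 ∧
      (∀ v, fderiv ℂ (r 0) 0 v = cf f 1 0 * v 0 + cf f 0 1 * v 2 + cf f 0 2 * v 3) ∧
      (∀ v, fderiv ℂ (r 1) 0 v =
        cf f 1 0 * v 1 + cf f 1 1 * v 0 + 2 * cf f 0 2 * v 2 + cf f 0 3 * v 3) := by
  induction f using MvPolynomial.induction_on with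
  | C c =>
    refine ⟨![fun _ => c, fun _ => 0], ?_, ?_, ?_⟩
    · simp [Fin.forall_fin_two, contDiff_const]
    · simp
    · simp [cf_C]
  | add f g hf hg =>
    obtain ⟨r, hr, hrY, h0, h1, d0, d1⟩ := hf
    obtain ⟨s, hs, hsY, h0', h1', d0', d1'⟩ := hg
    refine ⟨fun j t => r j t + s j t, fun j => (hr j).add (hs j), ?_, ?_, ?_, ?_, ?_⟩
    · intro t Y hY
      simp only [map_add, hrY t Y hY, hsY t Y hY]
      ring
    · simp [h0, h0', cf_add]
    · simp [h1, h1', cf_add]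
    · intro v
      have hd : ∀ j, DifferentiableAt ℂ (r j) 0 := fun j => (hr j).differentiable one_ne_zero _
      have hd' : ∀ j, DifferentiableAt ℂ (s j) 0 := fun j => (hs j).differentiable one_ne_zero _
      rw [fderiv_fun_add (hd 0) (hd' 0)]
      simp only [add_apply, d0, d0', cf_add]
      ring
    · intro v
      have hd : ∀ j, DifferentiableAt ℂ (r j) 0 := fun j => (hr j).differentiable one_ne_zero _
      have hd' : ∀ j, DifferentiableAt ℂ (s j) 0 := fun j => (hs j).differentiable one_ne_zero _
      rw [fderiv_fun_add (hd 1) (hd' 1)]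
      simp only [add_apply, d1, d1', cf_add]
      ring
  | mul_X f i hf =>
    obtain ⟨r, hr, hrY, h0, h1, d0, d1⟩ := hf
    have hd : ∀ j, HasFDerivAt (r j) (fderiv ℂ (r j) 0) 0 :=
      fun j => ((hr j).differentiable one_ne_zero _).hasFDerivAt
    have hp : ∀ j : Fin 4, HasFDerivAt (fun t : Fin 4 → ℂ => t j)
      (ContinuousLinearMap.proj j : (Fin 4 → ℂ) →L[ℂ] ℂ) 0 := fun j => hasFDerivAt_apply j _
    have hr0 := hr 0
    have hr1 := hr 1
    fin_cases i
    · refine ⟨![fun t => t 0 * r 0 t + t 1 * r 1 t * t 3, fun t => t 0 * r 1 t + t 1 * r 0 t],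
        ?_, ?_, ?_, ?_, ?_, ?_⟩
      · rw [Fin.forall_fin_two]
        constructor <;> simp <;> fun_prop
      · intro t Y hY
        simp [hrY t Y hY, ← hY]
        ring
      · simp [cf_mul_X_zero_zero]
      · simp [cf_mul_X_zero_zero]
      · intro v
        have := (((hp 0).fun_mul (hd 0)).fun_add (((hp 1).fun_mul (hd 1)).fun_mul (hp 3))).fderiv
        simp [this, cf_mul_X_zero_zero, cf_mul_X_zero_succ, h0, h1]
      · intro v
        have := (((hp 0).fun_mul (hd 1)).fun_add ((hp 1).fun_mul (hd 0))).fderiv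
        simp [this, cf_mul_X_zero_zero, cf_mul_X_zero_succ, h0, h1]
        ring
    · refine ⟨![fun t => t 2 * r 0 t + r 1 t * t 3, fun t => t 2 * r 1 t + r 0 t],
        ?_, ?_, ?_, ?_, ?_, ?_⟩
      · rw [Fin.forall_fin_two]
        constructor <;> simp <;> fun_prop
      · intro t Y hY
        simp [hrY t Y hY, ← hY]
        ring
      · simp [cf_mul_X_one_zero]
      · simp [cf_mul_X_one_succ, h0]
      · intro v
        have := (((hp 2).fun_mul (hd 0)).fun_add ((hd 1).fun_mul (hp 3))).fderiv
        simp [this, cf_mul_X_one_zero, cf_mul_X_one_succ, h0, h1]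
      · intro v
        have := (((hp 2).fun_mul (hd 1)).fun_add (hd 0)).fderiv
        simp [this, cf_mul_X_one_zero, cf_mul_X_one_succ, h1, d0]
        ring

/-- Reduction of `f (p₀ + p₁ Y + p₂ Y ^ 2, q + Y)` modulo `Y ^ 3 + X Y - Z`, as functions of
`t = (p₀, p₁, p₂, q, X, Z)`, with its first-order expansion at `t = 0`. -/
theorem exists_reduction_cubic (f : MvPolynomial (Fin 2) ℂ) :
    ∃ r : Fin 3 → (Fin 6 → ℂ) → ℂ, (∀ j, ContDiff ℂ 1 (r j)) ∧
      (∀ (t : Fin 6 → ℂ) (Y : ℂ), Y ^ 3 + t 4 * Y = t 5 →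
        eval ![t 0 + t 1 * Y + t 2 * Y ^ 2, t 3 + Y] f = r 0 t + r 1 t * Y + r 2 t * Y ^ 2) ∧
      r 0 0 = cf f 0 0 ∧ r 1 0 = cf f 0 1 ∧ r 2 0 = cf f 0 2 ∧
      (∀ v, fderiv ℂ (r 0) 0 v = cf f 1 0 * v 0 + cf f 0 1 * v 3 + cf f 0 3 * v 5) ∧
      (∀ v, fderiv ℂ (r 1) 0 v = cf f 1 0 * v 1 + cf f 1 1 * v 0 + 2 * cf f 0 2 * v 3 +
        cf f 0 4 * v 5 - cf f 0 3 * v 4) ∧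
      (∀ v, fderiv ℂ (r 2) 0 v = cf f 1 0 * v 2 + cf f 1 1 * v 1 + cf f 1 2 * v 0 +
        3 * cf f 0 3 * v 3 + cf f 0 5 * v 5 - cf f 0 4 * v 4) := by
  induction f using MvPolynomial.induction_on with
  | C c =>
    refine ⟨![fun _ => c, fun _ => 0, fun _ => 0], ?_, ?_, ?_⟩
    · simp [Fin.forall_fin_succ, contDiff_const]
    · simp
    · simp [cf_C]
  | add f g hf hg =>
    obtain ⟨r, hr, hrY, h0, h1, h2, d0, d1, d2⟩ := hf
    obtain ⟨s, hs, hsY, h0', h1', h2', d0', d1', d2'⟩ := hg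
    have hd : ∀ j, fderiv ℂ (fun t => r j t + s j t) 0 = fderiv ℂ (r j) 0 + fderiv ℂ (s j) 0 :=
      fun j => fderiv_fun_add ((hr j).differentiable one_ne_zero _)
        ((hs j).differentiable one_ne_zero _)
    refine ⟨fun j t => r j t + s j t, fun j => (hr j).add (hs j), ?_, ?_, ?_, ?_, ?_, ?_, ?_⟩
    · intro t Y hY
      simp only [map_add, hrY t Y hY, hsY t Y hY]
      ring
    · simp [h0, h0', cf_add]
    · simp [h1, h1', cf_add]
    · simp [h2, h2', cf_add]
    · intro v
      simp only [hd, add_apply, d0, d0', cf_add]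
      ring
    · intro v
      simp only [hd, add_apply, d1, d1', cf_add]
      ring
    · intro v
      simp only [hd, add_apply, d2, d2', cf_add]
      ring
  | mul_X f i hf =>
    obtain ⟨r, hr, hrY, h0, h1, h2, d0, d1, d2⟩ := hf
    have hd : ∀ j, HasFDerivAt (r j) (fderiv ℂ (r j) 0) 0 :=
      fun j => ((hr j).differentiable one_ne_zero _).hasFDerivAt
    have hp : ∀ j : Fin 6, HasFDerivAt (fun t : Fin 6 → ℂ => t j)
      (ContinuousLinearMap.proj j : (Fin 6 → ℂ) →L[ℂ] ℂ) 0 := fun j => hasFDerivAt_apply j _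
    have hr0 := hr 0
    have hr1 := hr 1
    have hr2 := hr 2
    fin_cases i
    · refine ⟨![fun t => t 0 * r 0 t + (t 1 * r 2 t + t 2 * r 1 t) * t 5,
          fun t => t 0 * r 1 t + t 1 * r 0 t - (t 1 * r 2 t + t 2 * r 1 t) * t 4 +
            t 2 * r 2 t * t 5,
          fun t => t 0 * r 2 t + t 1 * r 1 t + t 2 * r 0 t - t 2 * r 2 t * t 4],
        ?_, ?_, ?_, ?_, ?_, ?_, ?_, ?_⟩
      · simp only [Fin.forall_fin_succ, IsEmpty.forall_iff, and_true]
        refine ⟨?_, ?_, ?_⟩ <;> simp <;> fun_prop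
      · intro t Y hY
        simp [hrY t Y hY, ← hY]
        ring
      · simp [cf_mul_X_zero_zero]
      · simp [cf_mul_X_zero_zero]
      · simp [cf_mul_X_zero_zero]
      · intro v
        have := (((hp 0).fun_mul (hd 0)).fun_add ((((hp 1).fun_mul (hd 2)).fun_add
          ((hp 2).fun_mul (hd 1))).fun_mul (hp 5))).fderiv
        simp [this, cf_mul_X_zero_zero, cf_mul_X_zero_succ, h0, h1, h2]
      · intro v
        have := (((((hp 0).fun_mul (hd 1)).fun_add ((hp 1).fun_mul (hd 0))).fun_sub
          ((((hp 1).fun_mul (hd 2)).fun_add ((hp 2).fun_mul (hd 1))).fun_mul (hp 4))).fun_add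
          (((hp 2).fun_mul (hd 2)).fun_mul (hp 5))).fderiv
        simp [this, cf_mul_X_zero_zero, cf_mul_X_zero_succ, h0, h1, h2]
        ring
      · intro v
        have := (((((hp 0).fun_mul (hd 2)).fun_add ((hp 1).fun_mul (hd 1))).fun_add
          ((hp 2).fun_mul (hd 0))).fun_sub
          (((hp 2).fun_mul (hd 2)).fun_mul (hp 4))).fderiv
        simp [this, cf_mul_X_zero_zero, cf_mul_X_zero_succ, h0, h1, h2]
        ring
    · refine ⟨![fun t => t 3 * r 0 t + r 2 t * t 5,
          fun t => t 3 * r 1 t + r 0 t - r 2 t * t 4,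
          fun t => t 3 * r 2 t + r 1 t],
        ?_, ?_, ?_, ?_, ?_, ?_, ?_, ?_⟩
      · simp only [Fin.forall_fin_succ, IsEmpty.forall_iff, and_true]
        refine ⟨?_, ?_, ?_⟩ <;> simp <;> fun_prop
      · intro t Y hY
        simp [hrY t Y hY, ← hY]
        ring
      · simp [cf_mul_X_one_zero]
      · simp [cf_mul_X_one_succ, h0]
      · simp [cf_mul_X_one_succ, h1]
      · intro v
        have := (((hp 3).fun_mul (hd 0)).fun_add ((hd 2).fun_mul (hp 5))).fderiv
        simp [this, cf_mul_X_one_zero, cf_mul_X_one_succ, h0, h2]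
      · intro v
        have := ((((hp 3).fun_mul (hd 1)).fun_add (hd 0)).fun_sub
          ((hd 2).fun_mul (hp 4))).fderiv
        simp [this, cf_mul_X_one_zero, cf_mul_X_one_succ, h1, h2, d0]
        ring
      · intro v
        have := (((hp 3).fun_mul (hd 2)).fun_add (hd 1)).fderiv
        simp [this, cf_mul_X_one_zero, cf_mul_X_one_succ, h2, d1]
        ring

/-- Solving `θ t = θ 0 + c w` for `t` in terms of `w`. -/
theorem exists_local_solution {n : ℕ} (θ : Fin n → (Fin n → ℂ) → ℂ) (hθ : ∀ i, ContDiff ℂ 1 (θ i))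
    (hker : ∀ v, (∀ i, fderiv ℂ (θ i) 0 v = 0) → v = 0) (c : Fin n → Plane →L[ℂ] ℂ) :
    ∃ t : Plane → (Fin n → ℂ), ContDiffAt ℂ 1 t 0 ∧ t 0 = 0 ∧
      (∀ᶠ w in 𝓝 0, ∀ i, θ i (t w) = θ i 0 + c i w) ∧
      ∀ i v, fderiv ℂ (θ i) 0 (fderiv ℂ t 0 v) = c i v := by
  let Θ : (Fin n → ℂ) → (Fin n → ℂ) := fun t i => θ i t
  have hΘ : ContDiff ℂ 1 Θ := contDiff_pi.2 hθ
  have hdθ : ∀ i, HasFDerivAt (θ i) (fderiv ℂ (θ i) 0) 0 :=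
    fun i => ((hθ i).differentiable one_ne_zero _).hasFDerivAt
  have hd : HasFDerivAt Θ (ContinuousLinearMap.pi fun i => fderiv ℂ (θ i) 0) 0 :=
    hasFDerivAt_pi.2 hdθ
  obtain ⟨e, he⟩ := exists_equiv_of_ker_trivial (ContinuousLinearMap.pi fun i => fderiv ℂ (θ i) 0)
    (fun v hv => hker v fun i => congrFun hv i)
  rw [← he] at hd
  let R := (hΘ.contDiffAt).toOpenPartialHomeomorph Θ hd one_ne_zero
  have h0 : (0 : Fin n → ℂ) ∈ R.source :=
    hΘ.contDiffAt.mem_toOpenPartialHomeomorph_source hd one_ne_zero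
  have hs : ContDiffAt ℂ 1 R.symm (Θ 0) := hΘ.contDiffAt.to_localInverse hd one_ne_zero
  have hR0 : R.symm (Θ 0) = 0 := R.left_inv h0
  let C : Plane → (Fin n → ℂ) := fun w => Θ 0 + fun i => c i w
  have hC : ContDiff ℂ 1 C := contDiff_const.add (contDiff_pi.2 fun i => (c i).contDiff)
  have hC0 : C 0 = Θ 0 := by ext i; simp [C]
  have ht : ContDiffAt ℂ 1 (R.symm ∘ C) 0 := ContDiffAt.comp _ (hC0 ▸ hs) hC.contDiffAt
  have hev : ∀ᶠ w in 𝓝 0, ∀ i, θ i ((R.symm ∘ C) w) = θ i 0 + c i w := by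
    have hm : ∀ᶠ w in 𝓝 0, C w ∈ R.target :=
      hC.continuous.continuousAt.eventually_mem
        (hC0 ▸ R.open_target.mem_nhds (R.map_source h0))
    filter_upwards [hm] with w hw i
    exact congrFun (R.right_inv hw) i
  have ht0 : (R.symm ∘ C) 0 = 0 := by simp [hC0, hR0]
  refine ⟨R.symm ∘ C, ht, ht0, hev, fun i v => ?_⟩
  have h1 : HasFDerivAt (fun w => θ i ((R.symm ∘ C) w))
      ((fderiv ℂ (θ i) 0).comp (fderiv ℂ (R.symm ∘ C) 0)) 0 := by
    refine HasFDerivAt.comp (g := θ i) _ ?_ (ht.differentiableAt one_ne_zero).hasFDerivAt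
    rw [ht0]
    exact hdθ i
  have h2 : HasFDerivAt (fun w => θ i ((R.symm ∘ C) w)) (c i) 0 :=
    ((c i).hasFDerivAt.const_add (θ i 0)).congr_of_eventuallyEq (hev.mono fun w hw => hw i)
  exact congrArg (fun L => L v) (h1.unique h2)

section Vec2

variable {E : Type*} [NormedAddCommGroup E] [NormedSpace ℂ E] {p q : E → ℂ} {x : E}

theorem contDiffAt_vec2 (hp : ContDiffAt ℂ 1 p x) (hq : ContDiffAt ℂ 1 q x) :
    ContDiffAt ℂ 1 (fun z => (![p z, q z] : Plane)) x := by
  rw [contDiffAt_pi, Fin.forall_fin_two]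
  exact ⟨hp, hq⟩

theorem fderiv_vec2_apply (hp : DifferentiableAt ℂ p x) (hq : DifferentiableAt ℂ q x) (v : E) :
    fderiv ℂ (fun z => (![p z, q z] : Plane)) x v = ![fderiv ℂ p x v, fderiv ℂ q x v] := by
  have h : HasFDerivAt (fun z => (![p z, q z] : Plane))
      (ContinuousLinearMap.pi ![fderiv ℂ p x, fderiv ℂ q x]) x := by
    rw [hasFDerivAt_pi, Fin.forall_fin_two]
    exact ⟨hp.hasFDerivAt, hq.hasFDerivAt⟩
  rw [h.fderiv]
  ext i
  fin_cases i <;> rfl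

theorem eq_zero_of_vec2 {v : Plane} (h0 : v 0 = 0) (h1 : v 1 = 0) : v = 0 := by
  ext i
  fin_cases i <;> assumption

end Vec2

theorem fderiv_coord {n : ℕ} (j : Fin n) (x v : Fin n → ℂ) :
    fderiv ℂ (fun t : Fin n → ℂ => t j) x v = v j := by
  rw [(hasFDerivAt_apply j x).fderiv]
  rfl

/-- The fold map. -/
def foldMap : Plane → Plane := fun z => ![z 0, z 1 ^ 2]

/-- The cusp map. -/
def cuspMap : Plane → Plane := fun z => ![z 0, z 1 ^ 3 + z 0 * z 1]

theorem contDiff_foldMap : ContDiff ℂ 1 foldMap :=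
  contDiff_iff_contDiffAt.2 fun _ => contDiffAt_vec2 (by fun_prop) (by fun_prop)

theorem contDiff_cuspMap : ContDiff ℂ 1 cuspMap :=
  contDiff_iff_contDiffAt.2 fun _ => contDiffAt_vec2 (by fun_prop) (by fun_prop)

theorem foldMap_zero : foldMap 0 = 0 := eq_zero_of_vec2 (by simp [foldMap]) (by simp [foldMap])

theorem cuspMap_zero : cuspMap 0 = 0 := eq_zero_of_vec2 (by simp [cuspMap]) (by simp [cuspMap])

theorem fderiv_foldMap (v : Plane) : fderiv ℂ foldMap 0 v = ![v 0, 0] := by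
  unfold foldMap
  rw [fderiv_vec2_apply (by fun_prop) (by fun_prop), fderiv_coord]
  have hp : HasFDerivAt (fun t : Plane => t 1) (ContinuousLinearMap.proj 1 : Plane →L[ℂ] ℂ) 0 :=
    hasFDerivAt_apply 1 _
  have h := (hp.pow 2).fderiv
  simp at h
  simp [h]

theorem fderiv_cuspMap (v : Plane) : fderiv ℂ cuspMap 0 v = ![v 0, 0] := by
  unfold cuspMap
  rw [fderiv_vec2_apply (by fun_prop) (by fun_prop), fderiv_coord]
  have hp : HasFDerivAt (fun t : Plane => t 1) (ContinuousLinearMap.proj 1 : Plane →L[ℂ] ℂ) 0 :=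
    hasFDerivAt_apply 1 _
  have hq : HasFDerivAt (fun t : Plane => t 0) (ContinuousLinearMap.proj 0 : Plane →L[ℂ] ℂ) 0 :=
    hasFDerivAt_apply 0 _
  have h := ((hp.pow 3).fun_add (hq.fun_mul hp)).fderiv
  simp at h
  simp [h]

section Solution

variable {n : ℕ} {t : Plane → (Fin n → ℂ)} {κ : Plane → Plane}

theorem contDiffAt_comp_normalForm (ht : ContDiffAt ℂ 1 t 0) (hκ : ContDiff ℂ 1 κ)
    (hκ0 : κ 0 = 0) (j : Fin n) : ContDiffAt ℂ 1 (fun z => t (κ z) j) 0 := by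
  have : ContDiffAt ℂ 1 (fun z => t (κ z)) 0 :=
    ContDiffAt.comp (g := t) 0 (by rwa [hκ0]) hκ.contDiffAt
  exact contDiffAt_pi.1 this j

theorem hasFDerivAt_comp_normalForm (ht : ContDiffAt ℂ 1 t 0) (hκ : ContDiff ℂ 1 κ)
    (hκ0 : κ 0 = 0) (hκ' : ∀ v, fderiv ℂ κ 0 v = ![v 0, 0]) (j : Fin n) :
    ∃ M : Plane →L[ℂ] ℂ, HasFDerivAt (fun z => t (κ z) j) M 0 ∧
      ∀ v, M v = fderiv ℂ t 0 ![v 0, 0] j := by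
  have h1 : HasFDerivAt t (fderiv ℂ t 0) (κ 0) := by
    rw [hκ0]
    exact (ht.differentiableAt one_ne_zero).hasFDerivAt
  have h2 := h1.comp 0 (hκ.differentiable one_ne_zero 0).hasFDerivAt
  refine ⟨_, (hasFDerivAt_pi'.1 h2) j, fun v => ?_⟩
  rw [← hκ' v]
  rfl

end Solution

/-- Local parameters bringing a polynomial germ to the fold. -/
theorem exists_parameters_fold (f g : MvPolynomial (Fin 2) ℂ) (f10 : cf f 1 0 = 1)
    (f01 : cf f 0 1 = 0) (f02 : cf f 0 2 = 0) (g10 : cf g 1 0 = 0) (g01 : cf g 0 1 = 0)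
    (g02 : cf g 0 2 ≠ 0) :
    ∃ φ ψ, IsParametrizedBy (toFun ![f, g]) 0 foldMap φ ψ := by
  obtain ⟨r, hr, hrY, r0, r1, dr0, dr1⟩ := exists_reduction_quadratic f
  obtain ⟨s, hs, hsY, s0, s1, ds0, ds1⟩ := exists_reduction_quadratic g
  obtain ⟨t, ht, t0, tev, td⟩ := exists_local_solution ![r 0, r 1, s 1, fun t => t 3]
    (by
      simp only [Fin.forall_fin_succ, IsEmpty.forall_iff, and_true]
      exact ⟨hr 0, hr 1, hs 1, contDiff_apply ℂ ℂ 3⟩)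
    (by
      intro v hv
      have h0 : fderiv ℂ (r 0) 0 v = 0 := hv 0
      have h1 : fderiv ℂ (r 1) 0 v = 0 := hv 1
      have h2 : fderiv ℂ (s 1) 0 v = 0 := hv 2
      have h3 : fderiv ℂ (fun t : Fin 4 → ℂ => t 3) 0 v = 0 := hv 3
      rw [fderiv_coord] at h3
      simp only [dr0, dr1, ds1, f10, f01, f02, g10, h3] at h0 h1 h2
      have e0 : v 0 = 0 := by linear_combination h0
      simp only [e0] at h1 h2
      have e1 : v 1 = 0 := by linear_combination h1
      have e2 : v 2 = 0 := by
        have : cf g 0 2 * v 2 = 0 := by linear_combination h2 / 2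
        exact (mul_eq_zero.1 this).resolve_left g02
      ext i
      fin_cases i <;> assumption)
    ![ContinuousLinearMap.proj 0, 0, 0, ContinuousLinearMap.proj 1]
  have td0 : ∀ v, fderiv ℂ (r 0) 0 (fderiv ℂ t 0 v) = v 0 := td 0
  have td3 : ∀ v, fderiv ℂ (fun t : Fin 4 → ℂ => t 3) 0 (fderiv ℂ t 0 v) = v 1 := td 3
  simp only [fderiv_coord] at td3
  have htj := contDiffAt_comp_normalForm ht contDiff_foldMap foldMap_zero
  choose M hM hMv using
    hasFDerivAt_comp_normalForm ht contDiff_foldMap foldMap_zero fderiv_foldMap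
  have hp : HasFDerivAt (fun t : Plane => t 1) (ContinuousLinearMap.proj 1 : Plane →L[ℂ] ℂ) 0 :=
    hasFDerivAt_apply 1 _
  have hrt : ContDiffAt ℂ 1 (fun w => r 0 (t w)) 0 := (hr 0).contDiffAt.comp 0 ht
  have hst : ContDiffAt ℂ 1 (fun w => s 0 (t w)) 0 := (hs 0).contDiffAt.comp 0 ht
  have hp1 : ContDiffAt ℂ 1 (fun z : Plane => z 1) 0 := by fun_prop
  have hφ0 := (htj 0).add ((htj 1).mul hp1)
  have hφ1 := (htj 2).add hp1
  have hdt := ht.differentiableAt one_ne_zero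
  have hdr : DifferentiableAt ℂ (r 0) (t 0) := (hr 0).differentiable one_ne_zero _
  have hds : DifferentiableAt ℂ (s 0) (t 0) := (hs 0).differentiable one_ne_zero _
  refine ⟨fun z => ![t (foldMap z) 0 + t (foldMap z) 1 * z 1, t (foldMap z) 2 + z 1],
    fun w => ![r 0 (t w), s 0 (t w)], contDiffAt_vec2 hφ0 hφ1, contDiffAt_vec2 hrt hst,
    ?_, ?_, ?_, ?_⟩
  · exact eq_zero_of_vec2 (by simp [foldMap_zero, t0]) (by simp [foldMap_zero, t0])
  · intro v hv
    rw [fderiv_vec2_apply (hφ0.differentiableAt one_ne_zero) (hφ1.differentiableAt one_ne_zero),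
      ((hM 0).fun_add ((hM 1).fun_mul hp)).fderiv, ((hM 2).fun_add hp).fderiv] at hv
    have h0 := congrFun hv 0
    have h1 := congrFun hv 1
    have d0 := td0 ![v 0, 0]
    have d3 := td3 ![v 0, 0]
    simp [foldMap_zero, t0, hMv] at h0 h1
    simp [dr0, f10, f01, f02, h0] at d0
    rw [← d0, show (![0, 0] : Plane) = 0 from eq_zero_of_vec2 rfl rfl] at h1
    exact eq_zero_of_vec2 d0.symm (by simpa using h1)
  · intro v hv
    rw [fderiv_vec2_apply (hrt.differentiableAt one_ne_zero) (hst.differentiableAt one_ne_zero),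
      fderiv_fun_comp 0 hdr hdt, fderiv_fun_comp 0 hds hdt, t0] at hv
    have h0 := congrFun hv 0
    have h1 := congrFun hv 1
    simp [td0] at h0
    simp [ds0, g10, g01, td3, g02] at h1
    exact eq_zero_of_vec2 h0 h1
  · have hc := contDiff_foldMap.continuous.continuousAt (x := (0 : Plane))
    rw [ContinuousAt, foldMap_zero] at hc
    filter_upwards [hc.eventually tev] with z hz
    have h1 : r 1 (t (foldMap z)) = r 1 0 + 0 := hz 1
    have h2 : s 1 (t (foldMap z)) = s 1 0 + 0 := hz 2
    have h3 : t (foldMap z) 3 = 0 + z 1 ^ 2 := hz 3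
    rw [r1, f01, add_zero] at h1
    rw [s1, g01, add_zero] at h2
    have hY : z 1 ^ 2 = t (foldMap z) 3 := by rw [h3, zero_add]
    ext i
    fin_cases i
    · simpa [toFun, h1] using hrY _ _ hY
    · simpa [toFun, h2] using hsY _ _ hY

/-- Local parameters bringing a polynomial germ to the simple cusp. -/
theorem exists_parameters_cusp (f g : MvPolynomial (Fin 2) ℂ) (f10 : cf f 1 0 = 1)
    (f01 : cf f 0 1 = 0) (f02 : cf f 0 2 = 0) (g10 : cf g 1 0 = 0) (g01 : cf g 0 1 = 0)
    (g02 : cf g 0 2 = 0) (g11 : cf g 1 1 ≠ 0) (g03 : cf g 0 3 ≠ 0) :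
    ∃ φ ψ, IsParametrizedBy (toFun ![f, g]) 0 cuspMap φ ψ := by
  obtain ⟨r, hr, hrY, r0, r1, r2, dr0, dr1, dr2⟩ := exists_reduction_cubic f
  obtain ⟨s, hs, hsY, s0, s1, s2, ds0, ds1, ds2⟩ := exists_reduction_cubic g
  obtain ⟨t, ht, t0, tev, td⟩ := exists_local_solution
    ![r 1, r 2, s 1, s 2, fun t => t 4, fun t => t 5]
    (by
      simp only [Fin.forall_fin_succ, IsEmpty.forall_iff, and_true]
      exact ⟨hr 1, hr 2, hs 1, hs 2, contDiff_apply ℂ ℂ 4, contDiff_apply ℂ ℂ 5⟩)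
    (by
      intro v hv
      have h0 : fderiv ℂ (r 1) 0 v = 0 := hv 0
      have h1 : fderiv ℂ (r 2) 0 v = 0 := hv 1
      have h2 : fderiv ℂ (s 1) 0 v = 0 := hv 2
      have h3 : fderiv ℂ (s 2) 0 v = 0 := hv 3
      have h4 : fderiv ℂ (fun t : Fin 6 → ℂ => t 4) 0 v = 0 := hv 4
      have h5 : fderiv ℂ (fun t : Fin 6 → ℂ => t 5) 0 v = 0 := hv 5
      rw [fderiv_coord] at h4 h5
      simp only [dr1, dr2, ds1, ds2, f10, f02, g10, g02, h4, h5] at h0 h1 h2 h3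
      have e0 : v 0 = 0 := by
        have : cf g 1 1 * v 0 = 0 := by linear_combination h2
        exact (mul_eq_zero.1 this).resolve_left g11
      simp only [e0] at h0 h1 h3
      have e1 : v 1 = 0 := by linear_combination h0
      simp only [e1] at h1 h3
      have e3 : v 3 = 0 := by
        have : cf g 0 3 * v 3 = 0 := by linear_combination h3 / 3
        exact (mul_eq_zero.1 this).resolve_left g03
      simp only [e3] at h1
      have e2 : v 2 = 0 := by linear_combination h1
      ext i
      fin_cases i <;> assumption)
    ![0, 0, 0, 0, ContinuousLinearMap.proj 0, ContinuousLinearMap.proj 1]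
  have td2 : ∀ v, fderiv ℂ (s 1) 0 (fderiv ℂ t 0 v) = 0 := td 2
  have td4 : ∀ v, fderiv ℂ (fun t : Fin 6 → ℂ => t 4) 0 (fderiv ℂ t 0 v) = v 0 := td 4
  have td5 : ∀ v, fderiv ℂ (fun t : Fin 6 → ℂ => t 5) 0 (fderiv ℂ t 0 v) = v 1 := td 5
  simp only [fderiv_coord] at td4 td5
  simp only [ds1, g10, g02, td4, td5] at td2
  have htj := contDiffAt_comp_normalForm ht contDiff_cuspMap cuspMap_zero
  choose M hM hMv using
    hasFDerivAt_comp_normalForm ht contDiff_cuspMap cuspMap_zero fderiv_cuspMap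
  have hp : HasFDerivAt (fun t : Plane => t 1) (ContinuousLinearMap.proj 1 : Plane →L[ℂ] ℂ) 0 :=
    hasFDerivAt_apply 1 _
  have hrt : ContDiffAt ℂ 1 (fun w => r 0 (t w)) 0 := (hr 0).contDiffAt.comp 0 ht
  have hst : ContDiffAt ℂ 1 (fun w => s 0 (t w)) 0 := (hs 0).contDiffAt.comp 0 ht
  have hp1 : ContDiffAt ℂ 1 (fun z : Plane => z 1) 0 := by fun_prop
  have hφ0 := ((htj 0).add ((htj 1).mul hp1)).add (((htj 2).mul hp1).mul hp1)
  have hφ1 := (htj 3).add hp1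
  have hdt := ht.differentiableAt one_ne_zero
  have hdr : DifferentiableAt ℂ (r 0) (t 0) := (hr 0).differentiable one_ne_zero _
  have hds : DifferentiableAt ℂ (s 0) (t 0) := (hs 0).differentiable one_ne_zero _
  refine ⟨fun z => ![t (cuspMap z) 0 + t (cuspMap z) 1 * z 1 + t (cuspMap z) 2 * z 1 * z 1,
      t (cuspMap z) 3 + z 1],
    fun w => ![r 0 (t w), s 0 (t w)], contDiffAt_vec2 hφ0 hφ1, contDiffAt_vec2 hrt hst,
    ?_, ?_, ?_, ?_⟩
  · exact eq_zero_of_vec2 (by simp [cuspMap_zero, t0]) (by simp [cuspMap_zero, t0])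
  · intro v hv
    rw [fderiv_vec2_apply (hφ0.differentiableAt one_ne_zero) (hφ1.differentiableAt one_ne_zero),
      (((hM 0).fun_add ((hM 1).fun_mul hp)).fun_add (((hM 2).fun_mul hp).fun_mul hp)).fderiv,
      ((hM 3).fun_add hp).fderiv] at hv
    have h0 := congrFun hv 0
    have h1 := congrFun hv 1
    have d2 := td2 ![v 0, 0]
    simp [cuspMap_zero, t0, hMv] at h0 h1
    simp [h0, g03] at d2
    rw [d2, show (![0, 0] : Plane) = 0 from eq_zero_of_vec2 rfl rfl] at h1
    exact eq_zero_of_vec2 d2 (by simpa using h1)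
  · intro v hv
    rw [fderiv_vec2_apply (hrt.differentiableAt one_ne_zero) (hst.differentiableAt one_ne_zero),
      fderiv_fun_comp 0 hdr hdt, fderiv_fun_comp 0 hds hdt, t0] at hv
    have h0 := congrFun hv 0
    have h1 := congrFun hv 1
    have d2 := td2 v
    simp [ds0, g10, g01, td5, g03] at h1
    simp [dr0, f10, f01, td5, h1] at h0
    simp [h0, h1, g03] at d2
    exact eq_zero_of_vec2 d2 h1
  · have hc := contDiff_cuspMap.continuous.continuousAt (x := (0 : Plane))
    rw [ContinuousAt, cuspMap_zero] at hc
    filter_upwards [hc.eventually tev] with z hz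
    have h0 : r 1 (t (cuspMap z)) = r 1 0 + 0 := hz 0
    have h1 : r 2 (t (cuspMap z)) = r 2 0 + 0 := hz 1
    have h2 : s 1 (t (cuspMap z)) = s 1 0 + 0 := hz 2
    have h3 : s 2 (t (cuspMap z)) = s 2 0 + 0 := hz 3
    have h4 : t (cuspMap z) 4 = 0 + z 0 := hz 4
    have h5 : t (cuspMap z) 5 = 0 + (z 1 ^ 3 + z 0 * z 1) := hz 5
    rw [r1, f01, add_zero] at h0
    rw [r2, f02, add_zero] at h1
    rw [s1, g01, add_zero] at h2
    rw [s2, g02, add_zero] at h3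
    have hY : z 1 ^ 3 + t (cuspMap z) 4 * z 1 = t (cuspMap z) 5 := by
      rw [h4, h5, zero_add, zero_add]
    ext i
    fin_cases i
    · simpa [toFun, h0, h1, sq, mul_assoc] using hrY _ _ hY
    · simpa [toFun, h2, h3, sq, mul_assoc] using hsY _ _ hY

theorem pderiv_one_pderiv_zero (p : MvPolynomial (Fin 2) ℂ) :
    pderiv 1 (pderiv 0 p) = pderiv 0 (pderiv 1 p) := by
  induction p using MvPolynomial.induction_on with
  | C c => simp
  | add p q hp hq => simp [hp, hq]
  | mul_X p i hp =>
    fin_cases i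
    · simp [hp]
      ring
    · simp [hp]
      ring

/-- The differential of a polynomial function on the plane. -/
noncomputable def grad (p : MvPolynomial (Fin 2) ℂ) (x : Plane) : Plane →L[ℂ] ℂ :=
  eval x (pderiv 0 p) • ContinuousLinearMap.proj 0 +
    eval x (pderiv 1 p) • ContinuousLinearMap.proj 1

theorem grad_apply (p : MvPolynomial (Fin 2) ℂ) (x v : Plane) :
    grad p x v = eval x (pderiv 0 p) * v 0 + eval x (pderiv 1 p) * v 1 := rfl

theorem hasStrictFDerivAt_eval (p : MvPolynomial (Fin 2) ℂ) (x : Plane) :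
    HasStrictFDerivAt (fun x => eval x p) (grad p x) x := by
  have hX : ∀ i : Fin 2, HasStrictFDerivAt (fun x : Plane => x i)
      (ContinuousLinearMap.proj i : Plane →L[ℂ] ℂ) x := fun i => hasStrictFDerivAt_apply i x
  induction p using MvPolynomial.induction_on with
  | C c =>
    have h : grad (C c) x = 0 := by
      ext v
      simp [grad_apply]
    simpa [h] using hasStrictFDerivAt_const c x
  | add p q hp hq =>
    have h : grad (p + q) x = grad p x + grad q x := by
      ext v
      simp only [grad_apply, map_add, add_apply]
      ring
    simpa [h] using hp.fun_add hq
  | mul_X p i hp =>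
    have h : grad (p * X i) x =
        eval x p • (ContinuousLinearMap.proj i : Plane →L[ℂ] ℂ) + x i • grad p x := by
      ext v
      fin_cases i
      · simp [grad_apply]
        ring
      · simp [grad_apply]
        ring
    simpa [h] using hp.fun_mul (hX i)

theorem contDiff_eval (p : MvPolynomial (Fin 2) ℂ) : ContDiff ℂ 1 (fun x : Plane => eval x p) :=
  contDiff_iff_contDiffAt.2 fun x =>
    (AnalyticOnNhd.eval_mvPolynomial (𝕜 := ℂ) p x trivial).contDiffAt

theorem differential_apply (F : PolyPair) (a v : Plane) (k : Fin 2) :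
    differential F a v k = grad (F k) a v := by
  have h : HasFDerivAt (toFun F) (ContinuousLinearMap.pi fun k => grad (F k) a) a :=
    hasFDerivAt_pi.2 fun k => (hasStrictFDerivAt_eval (F k) a).hasFDerivAt
  simp only [differential, h.fderiv]
  rfl

theorem differentiableAt_jet (q : ℕ) (F : PolyPair) (a : Plane) :
    DifferentiableAt ℂ (jet q F) a := by
  have he : ∀ p : MvPolynomial (Fin 2) ℂ, DifferentiableAt ℂ (fun x : Plane => eval x p) a :=
    fun p => (hasStrictFDerivAt_eval p a).hasFDerivAt.differentiableAt
  refine differentiableAt_id.prodMk (DifferentiableAt.prodMk ?_ ?_)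
  · exact differentiableAt_pi.2 fun k => he _
  · exact differentiableAt_pi.2 fun k => differentiableAt_pi.2 fun d => he _

/-- The Jacobian determinant, with rows in the order `i`, `j`. -/
noncomputable def jac (F : PolyPair) (i j : Fin 2) : MvPolynomial (Fin 2) ℂ :=
  pderiv 0 (F i) * pderiv 1 (F j) - pderiv 1 (F i) * pderiv 0 (F j)

/-- The derivative of the Jacobian along the Hamiltonian field of `F i`. -/
noncomputable def cuspidal (F : PolyPair) (i j : Fin 2) : MvPolynomial (Fin 2) ℂ :=
  pderiv 0 (F i) * pderiv 1 (jac F i j) - pderiv 1 (F i) * pderiv 0 (jac F i j)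

section Corank

variable {F : PolyPair} {a : Plane} {i j : Fin 2}

theorem forall_fin_two_of_ne (hij : i ≠ j) {P : Fin 2 → Prop} (hi : P i) (hj : P j) (k : Fin 2) :
    P k := by
  have : k = i ∨ k = j := by omega
  rcases this with rfl | rfl <;> assumption

theorem jac_eq_zero_of_ker {v : Plane} (hv : v ≠ 0) (h : differential F a v = 0) (i j : Fin 2) :
    eval a (jac F i j) = 0 := by
  have h1 : ∀ k, eval a (pderiv 0 (F k)) * v 0 + eval a (pderiv 1 (F k)) * v 1 = 0 := fun k => by
    rw [← grad_apply, ← differential_apply, h]; rfl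
  simp only [jac, map_sub, map_mul]
  by_contra hne
  refine hv (eq_zero_of_vec2 ?_ ?_)
  · refine (mul_eq_zero.1 ?_).resolve_left hne
    linear_combination eval a (pderiv 1 (F j)) * h1 i - eval a (pderiv 1 (F i)) * h1 j
  · refine (mul_eq_zero.1 ?_).resolve_left hne
    linear_combination eval a (pderiv 0 (F i)) * h1 j - eval a (pderiv 0 (F j)) * h1 i

theorem exists_ker_of_corank_ne_zero {V W : Type*} [AddCommGroup V] [Module ℂ V]
    [AddCommGroup W] [Module ℂ W] {L : V →ₗ[ℂ] W} (h : corank L ≠ 0) :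
    ∃ v, v ≠ 0 ∧ L v = 0 := by
  have hne : LinearMap.ker L ≠ ⊥ := fun hb => h (by rw [corank, hb, finrank_bot])
  obtain ⟨v, hv, hv0⟩ := Submodule.exists_mem_ne_zero_of_ne_bot hne
  exact ⟨v, hv0, hv⟩

theorem pderiv_eq_zero_of_corank_two (h : corank (differential F a) = 2) (k : Fin 2) :
    eval a (pderiv 0 (F k)) = 0 ∧ eval a (pderiv 1 (F k)) = 0 := by
  have htop : LinearMap.ker (differential F a) = ⊤ :=
    Submodule.eq_top_of_finrank_eq (by rw [← corank, h]; simp)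
  have h1 : ∀ v, grad (F k) a v = 0 := fun v => by
    rw [← differential_apply]
    have : v ∈ LinearMap.ker (differential F a) := htop ▸ trivial
    rw [LinearMap.mem_ker.1 this]
    rfl
  constructor
  · simpa [grad_apply] using h1 ![1, 0]
  · simpa [grad_apply] using h1 ![0, 1]

/-- A plane vector annihilated by a nonzero row is a multiple of the orthogonal vector. -/
theorem eq_smul_of_row {f0 f1 e0 e1 : ℂ} (he : f0 * e0 + f1 * e1 = 1) {w : Plane}
    (hw : f0 * w 0 + f1 * w 1 = 0) : (w 1 * e0 - w 0 * e1) • (![-f1, f0] : Plane) = w := by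
  ext k
  fin_cases k
  · simp
    linear_combination w 0 * he - e0 * hw
  · simp
    linear_combination w 1 * he - e1 * hw

theorem row_ortho_ne_zero {f0 f1 e0 e1 : ℂ} (he : f0 * e0 + f1 * e1 = 1) :
    (![-f1, f0] : Plane) ≠ 0 := by
  intro h
  have h0 : -f1 = 0 := congrFun h 0
  have h1 : f0 = 0 := congrFun h 1
  rw [neg_eq_zero] at h0
  simp [h0, h1] at he

theorem differential_ortho (hij : i ≠ j) (hJ : eval a (jac F i j) = 0) :
    differential F a ![-eval a (pderiv 1 (F i)), eval a (pderiv 0 (F i))] = 0 := by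
  simp only [jac, map_sub, map_mul] at hJ
  ext k
  rw [differential_apply, grad_apply]
  refine forall_fin_two_of_ne hij (P := fun k => eval a (pderiv 0 (F k)) * _ +
    eval a (pderiv 1 (F k)) * _ = (0 : Plane) k) ?_ ?_ k
  · simp
    ring
  · simp
    linear_combination hJ

theorem finrank_eq_one_of_le_ker {f0 f1 e0 e1 : ℂ} (he : f0 * e0 + f1 * e1 = 1)
    {T : Submodule ℂ Plane} (hT : ∀ w ∈ T, f0 * w 0 + f1 * w 1 = 0)
    (hk : ![-f1, f0] ∈ T) : Module.finrank ℂ T = 1 := by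
  rw [finrank_eq_one_iff']
  refine ⟨⟨_, hk⟩, fun h => row_ortho_ne_zero he (congrArg Subtype.val h), fun w => ?_⟩
  exact ⟨_, Subtype.ext (eq_smul_of_row he (hT w w.2))⟩

theorem corank_eq_one {e0 e1 : ℂ} (hij : i ≠ j) (hJ : eval a (jac F i j) = 0)
    (he : eval a (pderiv 0 (F i)) * e0 + eval a (pderiv 1 (F i)) * e1 = 1) :
    corank (differential F a) = 1 := by
  refine finrank_eq_one_of_le_ker he (fun w hw => ?_)
    (LinearMap.mem_ker.2 (differential_ortho hij hJ))
  rw [← grad_apply, ← differential_apply, LinearMap.mem_ker.1 hw]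
  rfl

theorem exists_row_normalizer (h : ∃ k, eval a (pderiv 0 (F k)) ≠ 0 ∨ eval a (pderiv 1 (F k)) ≠ 0) :
    ∃ i j : Fin 2, i ≠ j ∧ ∃ e0 e1 : ℂ,
      eval a (pderiv 0 (F i)) * e0 + eval a (pderiv 1 (F i)) * e1 = 1 := by
  obtain ⟨k, hk⟩ := h
  refine ⟨k, k + 1, by simp, ?_⟩
  rcases hk with hk | hk
  · exact ⟨(eval a (pderiv 0 (F k)))⁻¹, 0, by field_simp; simp⟩
  · exact ⟨0, (eval a (pderiv 1 (F k)))⁻¹, by field_simp; simp⟩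

end Corank

section Jets

/-- The multi-index `(m, n)`. -/
abbrev dIdx (q m n : ℕ) (h : 1 ≤ m + n ∧ m + n ≤ q) : DerivIndex q :=
  ⟨(⟨m, by omega⟩, ⟨n, by omega⟩), h⟩

/-- The Jacobian determinant as a function of a jet. -/
def jetJac {q : ℕ} (hq : 1 ≤ q) (i j : Fin 2) (σ : Jet q) : ℂ :=
  σ.2.2 i (dIdx q 1 0 (by omega)) * σ.2.2 j (dIdx q 0 1 (by omega)) -
    σ.2.2 i (dIdx q 0 1 (by omega)) * σ.2.2 j (dIdx q 1 0 (by omega))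

/-- The derivative of the Jacobian along the Hamiltonian field of the component `i`, as a function
of a `2`-jet. -/
def jetCuspidal (i j : Fin 2) (σ : Jet 2) : ℂ :=
  let f := fun m n h => σ.2.2 i (dIdx 2 m n h)
  let g := fun m n h => σ.2.2 j (dIdx 2 m n h)
  f 1 0 (by omega) * (f 1 1 (by omega) * g 0 1 (by omega) + f 1 0 (by omega) * g 0 2 (by omega)
      - (f 0 2 (by omega) * g 1 0 (by omega) + f 0 1 (by omega) * g 1 1 (by omega))) -
    f 0 1 (by omega) * (f 2 0 (by omega) * g 0 1 (by omega) + f 1 0 (by omega) * g 1 1 (by omega)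
      - (f 1 1 (by omega) * g 1 0 (by omega) + f 0 1 (by omega) * g 2 0 (by omega)))

theorem jetJac_jet {q : ℕ} (hq : 1 ≤ q) (i j : Fin 2) (F : PolyPair) (a : Plane) :
    jetJac hq i j (jet q F a) = eval a (jac F i j) := by
  simp [jetJac, jet, jac]

theorem jetCuspidal_jet (i j : Fin 2) (F : PolyPair) (a : Plane) :
    jetCuspidal i j (jet 2 F a) = eval a (cuspidal F i j) := by
  simp [jetCuspidal, jet, cuspidal, jac, pderiv_one_pderiv_zero]
  ring

theorem differentiable_jetJac {q : ℕ} (hq : 1 ≤ q) (i j : Fin 2) :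
    Differentiable ℂ (jetJac hq i j) := by
  unfold jetJac
  fun_prop

theorem differentiable_jetCuspidal (i j : Fin 2) : Differentiable ℂ (jetCuspidal i j) := by
  unfold jetCuspidal
  dsimp only
  fun_prop

/-- Variation of the derivatives of order `m` of the component `j`. -/
def jetDirection (q : ℕ) (j : Fin 2) (α β : ℂ) (m : ℕ) : Jet q :=
  (0, 0, fun k d => if k = j ∧ (d.1.1 : ℕ) + (d.1.2 : ℕ) = m
    then α ^ (d.1.1 : ℕ) * β ^ (d.1.2 : ℕ) else 0)

theorem fderiv_eq_of_affine {V : Type*} [NormedAddCommGroup V] [NormedSpace ℂ V] {Φ : V → ℂ}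
    (hΦ : Differentiable ℂ Φ) {p v : V} {c : ℂ} (h : ∀ s : ℂ, Φ (p + s • v) = Φ p + s * c) :
    fderiv ℂ Φ p v = c := by
  have h1 : lineDeriv ℂ Φ p v = fderiv ℂ Φ p v := (hΦ p).lineDeriv_eq_fderiv
  rw [← h1, lineDeriv]
  simp only [h]
  rw [deriv_const_add, deriv_mul_const_field, deriv_id'', one_mul]

variable {i j : Fin 2} {e0 e1 : ℂ}

theorem fderiv_jetJac {q : ℕ} (hq : 1 ≤ q) (hij : i ≠ j) (σ : Jet q)
    (he : σ.2.2 i (dIdx q 1 0 (by omega)) * e0 + σ.2.2 i (dIdx q 0 1 (by omega)) * e1 = 1) :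
    fderiv ℂ (jetJac hq i j) σ (jetDirection q j (-e1) e0 1) = 1 := by
  refine fderiv_eq_of_affine (differentiable_jetJac hq i j) fun s => ?_
  simp [jetJac, jetDirection, hij]
  linear_combination s * he

theorem fderiv_jetJac_two (hij : i ≠ j) (σ : Jet 2) :
    fderiv ℂ (jetJac one_le_two i j) σ (jetDirection 2 j (-e1) e0 2) = 0 := by
  refine fderiv_eq_of_affine (differentiable_jetJac _ i j) fun s => ?_
  simp [jetJac, jetDirection, hij]

theorem fderiv_jetCuspidal_two (hij : i ≠ j) (σ : Jet 2)
    (he : σ.2.2 i (dIdx 2 1 0 (by omega)) * e0 + σ.2.2 i (dIdx 2 0 1 (by omega)) * e1 = 1) :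
    fderiv ℂ (jetCuspidal i j) σ (jetDirection 2 j (-e1) e0 2) = 1 := by
  refine fderiv_eq_of_affine (differentiable_jetCuspidal i j) fun s => ?_
  simp [jetCuspidal, jetDirection, hij]
  linear_combination s * (σ.2.2 i (dIdx 2 1 0 (by omega)) * e0 +
    σ.2.2 i (dIdx 2 0 1 (by omega)) * e1 + 1) * he

end Jets

variable {F : PolyPair} {a : Plane} {i j : Fin 2} {e0 e1 : ℂ}

theorem not_corank_two (h : TransversalAt (jet 1 F) (corankStratum 2) a) :
    corank (differential F a) ≠ 2 := by
  intro hc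
  let P : Jet 1 →L[ℂ] (Fin 2 → DerivIndex 1 → ℂ) :=
    (ContinuousLinearMap.snd ℂ Plane (Fin 2 → DerivIndex 1 → ℂ)).comp
      (ContinuousLinearMap.snd ℂ Plane (Plane × (Fin 2 → DerivIndex 1 → ℂ)))
  let E : Fin 2 → DerivIndex 1 → (Fin 2 → DerivIndex 1 → ℂ) →L[ℂ] ℂ := fun k d =>
    (ContinuousLinearMap.proj d : (DerivIndex 1 → ℂ) →L[ℂ] ℂ).comp (ContinuousLinearMap.proj k)
  let Q : (Fin 2 → DerivIndex 1 → ℂ) →L[ℂ] (Fin 2 → Fin 2 → ℂ) :=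
    ContinuousLinearMap.pi fun k => ContinuousLinearMap.pi
      ![E k (dIdx 1 1 0 (by omega)), E k (dIdx 1 0 1 (by omega))]
  have hs : Function.Surjective (Q.comp P) := by
    intro w
    refine ⟨(0, 0, fun k d => if (d.1.1 : ℕ) = 1 then w k 0 else w k 1), ?_⟩
    ext k l
    fin_cases l <;> simp [P, Q, E]
  have hsur := h.surjective_comp ⟨F, a, rfl, hc⟩ (differentiableAt_jet 1 F a)
    (Φ := Q.comp P) (Q.comp P).hasFDerivAt (by
      rintro _ ⟨G, b, rfl, hb⟩
      ext k l
      have := pderiv_eq_zero_of_corank_two hb k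
      fin_cases l
      · simpa [P, Q, E, jet] using this.1
      · simpa [P, Q, E, jet] using this.2) hs
    ((Q.comp P).hasFDerivAt.comp a (differentiableAt_jet 1 F a).hasFDerivAt)
  have := LinearMap.finrank_le_finrank_of_surjective
    (f := ((Q.comp P).comp (fderiv ℂ (jet 1 F) a)).toLinearMap) hsur
  rw [Module.finrank_pi_fintype] at this
  simp at this

/-- At a singular point not of corank two, some row of the Jacobian matrix is nonzero and the
Jacobian vanishes. -/
theorem exists_normalized_row (hs : IsSingularPoint F a)
    (h2 : corank (differential F a) ≠ 2) :
    ∃ i j : Fin 2, i ≠ j ∧ eval a (jac F i j) = 0 ∧ ∃ e0 e1 : ℂ,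
      eval a (pderiv 0 (F i)) * e0 + eval a (pderiv 1 (F i)) * e1 = 1 := by
  have hker : ∃ v, v ≠ 0 ∧ differential F a v = 0 := by
    by_contra! hne
    have hinj : Function.Injective (differential F a) := by
      rw [← LinearMap.ker_eq_bot, LinearMap.ker_eq_bot']
      exact fun v hv => by_contra fun hv0 => hne v hv0 hv
    exact hs ⟨hinj, LinearMap.injective_iff_surjective.1 hinj⟩
  obtain ⟨v, hv0, hv⟩ := hker
  have hrow : ∃ k, eval a (pderiv 0 (F k)) ≠ 0 ∨ eval a (pderiv 1 (F k)) ≠ 0 := by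
    by_contra! hne
    refine h2 ?_
    have : differential F a = 0 := by
      ext1 k
      ext1
      ext l
      simp [differential_apply, grad_apply, hne]
    rw [this, corank, LinearMap.ker_zero]
    simp
  obtain ⟨i, j, hij, e0, e1, he⟩ := exists_row_normalizer hrow
  exact ⟨i, j, hij, jac_eq_zero_of_ker hv0 hv i j, e0, e1, he⟩

theorem jac_eq_zero_of_corank_ne_zero (h : corank (differential F a) ≠ 0) (i j : Fin 2) :
    eval a (jac F i j) = 0 := by
  obtain ⟨v, hv0, hv⟩ := exists_ker_of_corank_ne_zero h
  exact jac_eq_zero_of_ker hv0 hv i j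

theorem jetJac_eq_zero_of_mem (i j : Fin 2) (σ : Jet 1) (hσ : σ ∈ corankStratum 1) :
    jetJac le_rfl i j σ = 0 := by
  obtain ⟨G, b, rfl, hb⟩ := hσ
  rw [jetJac_jet]
  exact jac_eq_zero_of_corank_ne_zero (by rw [hb]; exact one_ne_zero) i j

/-- Transversality to the corank one stratum makes the Jacobian a submersion. -/
theorem grad_jac_surjective (hij : i ≠ j) (hJ : eval a (jac F i j) = 0)
    (he : eval a (pderiv 0 (F i)) * e0 + eval a (pderiv 1 (F i)) * e1 = 1)
    (h : TransversalAt (jet 1 F) (corankStratum 1) a) : Function.Surjective (grad (jac F i j) a) := by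
  refine h.surjective_comp ⟨F, a, rfl, corank_eq_one hij hJ he⟩ (differentiableAt_jet 1 F a)
    (differentiable_jetJac le_rfl i j _).hasFDerivAt (jetJac_eq_zero_of_mem i j) ?_ ?_
  · intro w
    refine ⟨w • jetDirection 1 j (-e1) e0 1, ?_⟩
    rw [map_smul, fderiv_jetJac le_rfl hij _ (by simpa [jet] using he)]
    simp
  · have : jetJac le_rfl i j ∘ jet 1 F = fun x => eval x (jac F i j) :=
      funext fun x => jetJac_jet le_rfl i j F x
    rw [this]
    exact (hasStrictFDerivAt_eval _ _).hasFDerivAt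

theorem tangentSpaceAt_corankOneLocus_le (F : PolyPair) (a : Plane) (i j : Fin 2) :
    tangentSpaceAt (corankOneLocus F) a ≤ LinearMap.ker (grad (jac F i j) a).toLinearMap :=
  tangentSpaceAt_le_ker (hasStrictFDerivAt_eval _ _).hasFDerivAt fun x hx => by
    rw [← jetJac_jet le_rfl]
    exact jetJac_eq_zero_of_mem i j _ hx

theorem jetCuspidal_eq_zero_of_mem (i j : Fin 2) (σ : Jet 2) (hσ : σ ∈ secondStratum) :
    jetJac one_le_two i j σ = 0 ∧ jetCuspidal i j σ = 0 := by
  obtain ⟨G, b, rfl, hb, -, hc⟩ := hσ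
  rw [jetJac_jet, jetCuspidal_jet]
  obtain ⟨⟨v, hvT⟩, hv0, hv⟩ := exists_ker_of_corank_ne_zero (by rw [hc]; exact one_ne_zero)
  have hv0' : v ≠ 0 := fun h => hv0 (Subtype.ext h)
  have hv' : differential G b v = 0 := hv
  refine ⟨jac_eq_zero_of_ker hv0' hv' i j, ?_⟩
  have h1 : eval b (pderiv 0 (G i)) * v 0 + eval b (pderiv 1 (G i)) * v 1 = 0 := by
    rw [← grad_apply, ← differential_apply, hv']
    rfl
  have h2 : eval b (pderiv 0 (jac G i j)) * v 0 + eval b (pderiv 1 (jac G i j)) * v 1 = 0 :=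
    tangentSpaceAt_corankOneLocus_le G b i j hvT
  simp only [cuspidal, map_sub, map_mul]
  by_contra hne
  refine hv0' (eq_zero_of_vec2 ?_ ?_)
  · refine (mul_eq_zero.1 ?_).resolve_left hne
    linear_combination eval b (pderiv 1 (jac G i j)) * h1 - eval b (pderiv 1 (G i)) * h2
  · refine (mul_eq_zero.1 ?_).resolve_left hne
    linear_combination eval b (pderiv 0 (G i)) * h2 - eval b (pderiv 0 (jac G i j)) * h1

/-- If the kernel of `d_a F` is tangent to the smooth critical curve, the `2`-jet of `F` lies in the
second stratum. -/
theorem jet_mem_secondStratum (hij : i ≠ j) (hJ : eval a (jac F i j) = 0)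
    (he : eval a (pderiv 0 (F i)) * e0 + eval a (pderiv 1 (F i)) * e1 = 1)
    (h : TransversalAt (jet 1 F) (corankStratum 1) a) (hD : eval a (cuspidal F i j) = 0) :
    jet 2 F a ∈ secondStratum := by
  refine ⟨F, a, rfl, ⟨F, a, rfl, corank_eq_one hij hJ he⟩, h, ?_⟩
  have hsur := grad_jac_surjective hij hJ he h
  have hne : grad (jac F i j) a ≠ 0 := by
    intro h0
    obtain ⟨v, hv⟩ := hsur 1
    simp [h0] at hv
  let f0 := eval a (pderiv 0 (F i))
  let f1 := eval a (pderiv 1 (F i))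
  have hT : ∀ w ∈ tangentSpaceAt (corankOneLocus F) a, f0 * w 0 + f1 * w 1 = 0 := by
    intro w hw
    have hw' : eval a (pderiv 0 (jac F i j)) * w 0 + eval a (pderiv 1 (jac F i j)) * w 1 = 0 :=
      tangentSpaceAt_corankOneLocus_le F a i j hw
    simp only [cuspidal, map_sub, map_mul] at hD
    by_contra hw0
    refine hne ?_
    ext v
    have e0 : eval a (pderiv 0 (jac F i j)) = 0 := by
      refine (mul_eq_zero.1 ?_).resolve_right hw0
      linear_combination f0 * hw' - w 1 * hD
    have e1 : eval a (pderiv 1 (jac F i j)) = 0 := by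
      refine (mul_eq_zero.1 ?_).resolve_right hw0
      linear_combination f1 * hw' + w 0 * hD
    simp [grad_apply, e0, e1]
  have hbot : tangentSpaceAt (corankOneLocus F) a ≠ ⊥ := by
    refine tangentSpaceAt_ne_bot (hasStrictFDerivAt_eval (jac F i j) a) hne hJ ?_
    have hcont : Continuous fun x : Plane =>
        eval x (pderiv 0 (F i)) * e0 + eval x (pderiv 1 (F i)) * e1 :=
      ((contDiff_eval _).continuous.mul continuous_const).add
        ((contDiff_eval _).continuous.mul continuous_const)
    have hev : ∀ᶠ x in 𝓝 a, eval x (pderiv 0 (F i)) * e0 + eval x (pderiv 1 (F i)) * e1 ≠ 0 :=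
      hcont.continuousAt.eventually_ne (by rw [he]; exact one_ne_zero)
    filter_upwards [hev] with x hx hxJ
    refine ⟨F, x, rfl, corank_eq_one hij hxJ
      (e0 := e0 / (eval x (pderiv 0 (F i)) * e0 + eval x (pderiv 1 (F i)) * e1))
      (e1 := e1 / (eval x (pderiv 0 (F i)) * e0 + eval x (pderiv 1 (F i)) * e1)) ?_⟩
    rw [← mul_div_assoc, ← mul_div_assoc, ← add_div, div_self hx]
  obtain ⟨u, huT, hu0⟩ := Submodule.exists_mem_ne_zero_of_ne_bot hbot
  have hu := eq_smul_of_row he (hT u huT)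
  have hk : (![-f1, f0] : Plane) ∈ tangentSpaceAt (corankOneLocus F) a := by
    have hc : u 1 * e0 - u 0 * e1 ≠ 0 := by
      intro hc
      rw [hc, zero_smul] at hu
      exact hu0 hu.symm
    rw [← hu] at huT
    exact (Submodule.smul_mem_iff _ hc).1 huT
  have hker : LinearMap.ker ((differential F a).domRestrict
      (tangentSpaceAt (corankOneLocus F) a)) = ⊤ := by
    rw [eq_top_iff]
    rintro ⟨w, hw⟩ -
    have hw' := congrArg (differential F a) (eq_smul_of_row he (hT w hw))
    rw [map_smul, differential_ortho hij hJ, smul_zero] at hw'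
    exact hw'.symm
  rw [corank, hker, finrank_top]
  exact finrank_eq_one_of_le_ker he hT hk

/-- At a point of the second stratum, transversality makes the differentials of the Jacobian and
of its derivative along the kernel field independent. -/
theorem independent_of_transversal_second (hij : i ≠ j)
    (he : eval a (pderiv 0 (F i)) * e0 + eval a (pderiv 1 (F i)) * e1 = 1)
    (hm : jet 2 F a ∈ secondStratum) (h : TransversalAt (jet 2 F) secondStratum a) :
    eval a (pderiv 0 (jac F i j)) * eval a (pderiv 1 (cuspidal F i j)) -
      eval a (pderiv 1 (jac F i j)) * eval a (pderiv 0 (cuspidal F i j)) ≠ 0 := by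
  let L1 := fderiv ℂ (jetJac one_le_two i j) (jet 2 F a)
  let L2 := fderiv ℂ (jetCuspidal i j) (jet 2 F a)
  let Φ : Jet 2 → Plane := fun σ => ![jetJac one_le_two i j σ, jetCuspidal i j σ]
  have hΦ : HasFDerivAt Φ (ContinuousLinearMap.pi ![L1, L2]) (jet 2 F a) := by
    rw [hasFDerivAt_pi, Fin.forall_fin_two]
    exact ⟨(differentiable_jetJac one_le_two i j _).hasFDerivAt,
      (differentiable_jetCuspidal i j _).hasFDerivAt⟩
  have hrow : (jet 2 F a).2.2 i (dIdx 2 1 0 (by omega)) * e0 +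
      (jet 2 F a).2.2 i (dIdx 2 0 1 (by omega)) * e1 = 1 := by simpa [jet] using he
  have hsur := h.surjective_comp hm (differentiableAt_jet 2 F a) hΦ
    (fun σ hσ => eq_zero_of_vec2 (jetCuspidal_eq_zero_of_mem i j σ hσ).1
      (jetCuspidal_eq_zero_of_mem i j σ hσ).2)
    (M := ContinuousLinearMap.pi ![grad (jac F i j) a, grad (cuspidal F i j) a]) (by
      intro w
      let v1 := jetDirection 2 j (-e1) e0 1
      let v2 := jetDirection 2 j (-e1) e0 2
      have h1 : L1 v1 = 1 := fderiv_jetJac one_le_two hij _ hrow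
      have h2 : L1 v2 = 0 := fderiv_jetJac_two hij _
      have h3 : L2 v2 = 1 := fderiv_jetCuspidal_two hij _ hrow
      refine ⟨w 0 • v1 + (w 1 - w 0 * L2 v1) • v2, ?_⟩
      ext k
      fin_cases k
      · simp [h1, h2]
      · simp [h3]) (by
      rw [hasFDerivAt_pi, Fin.forall_fin_two]
      constructor
      · have : (fun x => (Φ ∘ jet 2 F) x 0) = fun x => eval x (jac F i j) :=
          funext fun x => jetJac_jet one_le_two i j F x
        rw [this]
        exact (hasStrictFDerivAt_eval _ _).hasFDerivAt
      · have : (fun x => (Φ ∘ jet 2 F) x 1) = fun x => eval x (cuspidal F i j) :=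
          funext fun x => jetCuspidal_jet i j F x
        rw [this]
        exact (hasStrictFDerivAt_eval _ _).hasFDerivAt)
  intro hdet
  obtain ⟨u, hu⟩ := hsur ![1, 0]
  obtain ⟨v, hv⟩ := hsur ![0, 1]
  have hu0 : grad (jac F i j) a u = 1 := congrFun hu 0
  have hu1 : grad (cuspidal F i j) a u = 0 := congrFun hu 1
  have hv0 : grad (jac F i j) a v = 0 := congrFun hv 0
  have hv1 : grad (cuspidal F i j) a v = 1 := congrFun hv 1
  rw [grad_apply] at hu0 hu1 hv0 hv1
  have hprod := congrArg₂ (fun x y : ℂ => x * y) hu0 hv1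
  have hprod' := congrArg₂ (fun x y : ℂ => x * y) hv0 hu1
  have : (1 : ℂ) = 0 := by
    linear_combination (u 0 * v 1 - u 1 * v 0) * hdet - hprod + hprod'
  exact one_ne_zero this

section Substitution

variable (a e k : Plane) (β : ℂ)

/-- The components of `(x, y) ↦ a + (x - β y ^ 2) e + y k`. -/
noncomputable def shear (l : Fin 2) : MvPolynomial (Fin 2) ℂ :=
  C (a l) + C (e l) * (X 0 - C β * X 1 ^ 2) + C (k l) * X 1

/-- The substitution of `shear`. -/
noncomputable def sub (p : MvPolynomial (Fin 2) ℂ) : MvPolynomial (Fin 2) ℂ :=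
  bind₁ (shear a e k β) p

theorem eval_sub (x : Plane) (p : MvPolynomial (Fin 2) ℂ) :
    eval x (sub a e k β p) = eval (toFun (shear a e k β) x) p := by
  simp only [sub, eval, eval₂Hom_bind₁]
  rfl

theorem toFun_shear_zero : toFun (shear a e k β) 0 = a := by
  ext l
  simp [toFun, shear]

theorem pderiv_zero_sub (p : MvPolynomial (Fin 2) ℂ) :
    pderiv 0 (sub a e k β p) =
      C (e 0) * sub a e k β (pderiv 0 p) + C (e 1) * sub a e k β (pderiv 1 p) := by
  unfold sub
  induction p using MvPolynomial.induction_on with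
  | C c => simp
  | add p q hp hq =>
    simp only [map_add, hp, hq]
    ring
  | mul_X p i hp =>
    fin_cases i
    · simp [hp]
      simp [shear]
      ring
    · simp [hp]
      simp [shear]
      ring

theorem pderiv_one_sub (p : MvPolynomial (Fin 2) ℂ) :
    pderiv 1 (sub a e k β p) =
      (C (k 0) - C (2 * β * e 0) * X 1) * sub a e k β (pderiv 0 p) +
      (C (k 1) - C (2 * β * e 1) * X 1) * sub a e k β (pderiv 1 p) := by
  unfold sub
  have h2 : (C 2 : MvPolynomial (Fin 2) ℂ) = 2 := map_ofNat C 2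
  induction p using MvPolynomial.induction_on with
  | C c => simp
  | add p q hp hq =>
    simp only [map_add, hp, hq]
    ring
  | mul_X p i hp =>
    fin_cases i
    · simp [hp]
      simp [shear, h2]
      ring
    · simp [hp]
      simp [shear, h2]
      ring

variable {a e k β} (p : MvPolynomial (Fin 2) ℂ)

theorem constantCoeff_sub : constantCoeff (sub a e k β p) = eval a p := by
  rw [← eval_zero, eval_sub, toFun_shear_zero]

theorem cf_sub_one_zero : cf (sub a e k β p) 1 0 =
    e 0 * eval a (pderiv 0 p) + e 1 * eval a (pderiv 1 p) := by
  have h := cf_pderiv_zero (sub a e k β p) 0 0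
  rw [← constantCoeff_eq_cf, pderiv_zero_sub] at h
  simp [constantCoeff_sub] at h
  exact h.symm

theorem cf_sub_zero_one : cf (sub a e k β p) 0 1 =
    k 0 * eval a (pderiv 0 p) + k 1 * eval a (pderiv 1 p) := by
  have h := cf_pderiv_one (sub a e k β p) 0 0
  rw [← constantCoeff_eq_cf, pderiv_one_sub] at h
  simp [constantCoeff_sub] at h
  exact h.symm

theorem cf_sub_one_one : cf (sub a e k β p) 1 1 =
    e 0 * (k 0 * eval a (pderiv 0 (pderiv 0 p)) + k 1 * eval a (pderiv 0 (pderiv 1 p))) +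
    e 1 * (k 0 * eval a (pderiv 0 (pderiv 1 p)) + k 1 * eval a (pderiv 1 (pderiv 1 p))) := by
  have h := cf_pderiv_zero (pderiv 1 (sub a e k β p)) 0 0
  rw [cf_pderiv_one (sub a e k β p), ← constantCoeff_eq_cf, pderiv_one_sub] at h
  simp [constantCoeff_sub, pderiv_zero_sub, pderiv_one_pderiv_zero] at h
  rw [← h]
  ring

theorem cf_sub_zero_two : 2 * cf (sub a e k β p) 0 2 =
    k 0 ^ 2 * eval a (pderiv 0 (pderiv 0 p)) + 2 * k 0 * k 1 * eval a (pderiv 0 (pderiv 1 p)) +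
      k 1 ^ 2 * eval a (pderiv 1 (pderiv 1 p)) -
      2 * β * (e 0 * eval a (pderiv 0 p) + e 1 * eval a (pderiv 1 p)) := by
  have h := cf_pderiv_one (pderiv 1 (sub a e k β p)) 0 0
  rw [cf_pderiv_one (sub a e k β p), ← constantCoeff_eq_cf, pderiv_one_sub] at h
  simp [constantCoeff_sub, pderiv_one_sub, pderiv_one_pderiv_zero] at h
  linear_combination -h

theorem cf_sub_zero_three : 6 * cf (sub a e k β p) 0 3 =
    k 0 ^ 3 * eval a (pderiv 0 (pderiv 0 (pderiv 0 p))) +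
      3 * k 0 ^ 2 * k 1 * eval a (pderiv 0 (pderiv 0 (pderiv 1 p))) +
      3 * k 0 * k 1 ^ 2 * eval a (pderiv 0 (pderiv 1 (pderiv 1 p))) +
      k 1 ^ 3 * eval a (pderiv 1 (pderiv 1 (pderiv 1 p))) -
      6 * β * cf (sub a e k β p) 1 1 := by
  have h := cf_pderiv_one (pderiv 1 (pderiv 1 (sub a e k β p))) 0 0
  rw [cf_pderiv_one (pderiv 1 (sub a e k β p)), cf_pderiv_one (sub a e k β p),
    ← constantCoeff_eq_cf, pderiv_one_sub] at h
  rw [cf_sub_one_one]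
  simp [constantCoeff_sub, pderiv_one_sub, pderiv_one_pderiv_zero] at h
  linear_combination -h

theorem cf_sub_C_mul (f g : MvPolynomial (Fin 2) ℂ) (c : ℂ) (m n : ℕ) :
    cf (g - C c * f) m n = cf g m n - c * cf f m n := by
  simp [cf]

theorem fderiv_toFun_apply (F : PolyPair) (x v : Plane) (l : Fin 2) :
    fderiv ℂ (toFun F) x v l = grad (F l) x v := differential_apply F x v l

theorem fderiv_shear_apply (v : Plane) (l : Fin 2) :
    fderiv ℂ (toFun (shear a e k β)) 0 v l = e l * v 0 + k l * v 1 := by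
  rw [fderiv_toFun_apply, grad_apply]
  simp [shear]

theorem contDiff_toFun (F : PolyPair) : ContDiff ℂ 1 (toFun F) :=
  contDiff_pi.2 fun l => contDiff_eval (F l)

end Substitution

section Target

variable {i j : Fin 2} {lam : ℂ}

/-- The linear map of the target recovering the components `i`, `j` from `(Fᵢ, Fⱼ - λ Fᵢ)`. -/
noncomputable def recombine (i : Fin 2) (lam : ℂ) : Plane →L[ℂ] Plane :=
  ContinuousLinearMap.pi fun l => if l = i then ContinuousLinearMap.proj 0
    else ContinuousLinearMap.proj 1 + lam • ContinuousLinearMap.proj 0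

theorem recombine_apply_left (w : Plane) : recombine i lam w i = w 0 := by
  simp [recombine]

theorem recombine_apply_right (hij : i ≠ j) (w : Plane) :
    recombine i lam w j = w 1 + lam * w 0 := by
  simp [recombine, hij.symm]

theorem recombine_ker (hij : i ≠ j) (w : Plane) (hw : recombine i lam w = 0) : w = 0 := by
  have h0 := congrFun hw i
  have h1 := congrFun hw j
  rw [recombine_apply_left] at h0
  rw [recombine_apply_right hij, h0] at h1
  exact eq_zero_of_vec2 h0 (by simpa using h1)

end Target


/-- Local parameters for the normalized germ give local parameters for the original one. -/
theorem IsParametrizedBy.of_normalized {κ : Plane → Plane} {e k : Plane} {β lam f0 f1 : ℂ}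
    (hij : i ≠ j) (he : f0 * e 0 + f1 * e 1 = 1) (hk0 : k 0 = -f1) (hk1 : k 1 = f0)
    (hκ : Continuous κ) (hκ0 : κ 0 = 0)
    (h : ∃ φ ψ, IsParametrizedBy
      (toFun ![sub a e k β (F i), sub a e k β (F j) - C lam * sub a e k β (F i)]) 0 κ φ ψ) :
    GermEquiv (toFun F) a κ 0 := by
  obtain ⟨φ, ψ, h⟩ := h
  refine (h.comp (F := toFun F) (contDiff_toFun (shear a e k β))
    (recombine i lam).contDiff (toFun_shear_zero a e k β) ?_ ?_ ?_).germEquiv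
    hκ.continuousAt hκ0
  · intro v hv
    have h0 := congrFun hv 0
    have h1 := congrFun hv 1
    rw [fderiv_shear_apply] at h0 h1
    simp only [hk0, hk1, Pi.zero_apply] at h0 h1
    exact eq_zero_of_vec2 (by linear_combination f0 * h0 + f1 * h1 - v 0 * he)
      (by linear_combination e 0 * h1 - e 1 * h0 - v 1 * he)
  · intro v hv
    rw [ContinuousLinearMap.fderiv] at hv
    exact recombine_ker hij v hv
  · intro z
    ext l
    refine forall_fin_two_of_ne hij (P := fun l => toFun F (toFun (shear a e k β) z) l =
      recombine i lam (toFun _ z) l) ?_ ?_ l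
    · rw [recombine_apply_left]
      simp [toFun, eval_sub]
    · rw [recombine_apply_right hij]
      simp [toFun, eval_sub]

section Coefficients

variable {e k : Plane} {β lam : ℂ}

/-- The quadratic coefficient of the normalized second component is the derivative of the Jacobian
along the kernel field. -/
theorem two_mul_cf_zero_two (hk : k = ![-eval a (pderiv 1 (F i)), eval a (pderiv 0 (F i))])
    (hg0 : eval a (pderiv 0 (F j)) = lam * eval a (pderiv 0 (F i)))
    (hg1 : eval a (pderiv 1 (F j)) = lam * eval a (pderiv 1 (F i))) :
    2 * cf (sub a e k β (F j) - C lam * sub a e k β (F i)) 0 2 = eval a (cuspidal F i j) := by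
  have h1 := cf_sub_zero_two (a := a) (e := e) (k := k) (β := β) (F i)
  have h2 := cf_sub_zero_two (a := a) (e := e) (k := k) (β := β) (F j)
  rw [cf_sub_C_mul, mul_sub, mul_left_comm, h1, h2, hg0, hg1]
  simp [cuspidal, jac, pderiv_one_pderiv_zero, hk, hg0, hg1]
  ring

/-- On the critical curve's tangency locus, the Jacobian of the Jacobian and its kernel derivative
is the product of the two coefficients governing the cusp. -/
theorem det_eq_mul_cf (hk : k = ![-eval a (pderiv 1 (F i)), eval a (pderiv 0 (F i))])
    (he : eval a (pderiv 0 (F i)) * e 0 + eval a (pderiv 1 (F i)) * e 1 = 1)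
    (hg0 : eval a (pderiv 0 (F j)) = lam * eval a (pderiv 0 (F i)))
    (hg1 : eval a (pderiv 1 (F j)) = lam * eval a (pderiv 1 (F i)))
    (hβ : cf (sub a e k β (F i)) 0 2 = 0) (hD : eval a (cuspidal F i j) = 0) :
    eval a (pderiv 0 (jac F i j)) * eval a (pderiv 1 (cuspidal F i j)) -
      eval a (pderiv 1 (jac F i j)) * eval a (pderiv 0 (cuspidal F i j)) =
    cf (sub a e k β (F j) - C lam * sub a e k β (F i)) 1 1 *
      (6 * cf (sub a e k β (F j) - C lam * sub a e k β (F i)) 0 3) := by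
  set f0 := eval a (pderiv 0 (F i)) with hf0
  set f1 := eval a (pderiv 1 (F i)) with hf1
  set μ := cf (sub a e k β (F j) - C lam * sub a e k β (F i)) 1 1 with hμ
  set J0 := eval a (pderiv 0 (jac F i j)) with hJ0
  set J1 := eval a (pderiv 1 (jac F i j)) with hJ1
  have hD' : f0 * J1 - f1 * J0 = 0 := by
    rw [← hD]
    simp [cuspidal, hf0, hf1, hJ0, hJ1]
  have hμJ : μ = e 0 * J0 + e 1 * J1 := by
    rw [hμ, cf_sub_C_mul, cf_sub_one_one, cf_sub_one_one, hJ0, hJ1]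
    simp [jac, pderiv_one_pderiv_zero, hk, hg0, hg1, ← hf0, ← hf1]
    ring
  have h0 : J0 = μ * f0 := by
    rw [hμJ]
    linear_combination -J0 * he - e 1 * hD'
  have h1 : J1 = μ * f1 := by
    rw [hμJ]
    linear_combination -J1 * he + e 0 * hD'
  have h2 := cf_sub_zero_two (a := a) (e := e) (k := k) (β := β) (F i)
  rw [hβ, ← hf0, ← hf1] at h2
  have key : f0 * eval a (pderiv 1 (cuspidal F i j)) - f1 * eval a (pderiv 0 (cuspidal F i j)) =
      6 * cf (sub a e k β (F j) - C lam * sub a e k β (F i)) 0 3 := by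
    have h3 := cf_sub_zero_three (a := a) (e := e) (k := k) (β := β) (F i)
    have h4 := cf_sub_zero_three (a := a) (e := e) (k := k) (β := β) (F j)
    rw [cf_sub_C_mul] at hμ
    rw [cf_sub_C_mul, mul_sub, mul_left_comm, h3, h4]
    have h0' := h0
    have h1' := h1
    rw [hJ0] at h0'
    rw [hJ1] at h1'
    simp [jac, pderiv_one_pderiv_zero, hg0, hg1, ← hf0, ← hf1] at h0' h1'
    have hk0 : k 0 = -f1 := congrFun hk 0
    have hk1 : k 1 = f0 := congrFun hk 1
    simp [hk0, hk1] at h2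
    simp [cuspidal, jac, pderiv_one_pderiv_zero, hk0, hk1, hg0, hg1, ← hf0, ← hf1]
    linear_combination
      3 * (-(-f1 * eval a (pderiv 0 (pderiv 1 (F i))) + f0 * eval a (pderiv 1 (pderiv 1 (F i))))) * h0' +
      3 * (-f1 * eval a (pderiv 0 (pderiv 0 (F i))) + f0 * eval a (pderiv 0 (pderiv 1 (F i)))) * h1' +
      3 * μ * h2 - 6 * μ * β * he - 6 * β * hμ
  rw [← key]
  linear_combination (eval a (pderiv 1 (cuspidal F i j))) * h0 -
    (eval a (pderiv 0 (cuspidal F i j))) * h1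

end Coefficients

end PlaneMap

open PlaneMap in
theorem mainTheorem6 (F : PlaneMap.PolyPair) (hF : PlaneMap.IsGeneric F) :
    ∀ a : PlaneMap.Plane, PlaneMap.IsSingularPoint F a →
      PlaneMap.IsTwoFold (PlaneMap.toFun F) a ∨ PlaneMap.IsSimpleCusp (PlaneMap.toFun F) a := by
  intro a ha
  obtain ⟨i, j, hij, hJ, e0, e1, he⟩ :=
    exists_normalized_row ha (not_corank_two (hF.transversal_corank_two a))
  set f0 := eval a (pderiv 0 (F i)) with hf0
  set f1 := eval a (pderiv 1 (F i)) with hf1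
  set g0 := eval a (pderiv 0 (F j)) with hg0
  set g1 := eval a (pderiv 1 (F j)) with hg1
  let e : Plane := ![e0, e1]
  let k : Plane := ![-f1, f0]
  let lam : ℂ := g0 * e0 + g1 * e1
  have hJ' : f0 * g1 - f1 * g0 = 0 := by simpa [jac] using hJ
  have hl0 : g0 = lam * f0 := by linear_combination -g0 * he - e1 * hJ'
  have hl1 : g1 = lam * f1 := by linear_combination -g1 * he + e0 * hJ'
  let β : ℂ := (k 0 ^ 2 * eval a (pderiv 0 (pderiv 0 (F i))) +
    2 * k 0 * k 1 * eval a (pderiv 0 (pderiv 1 (F i))) +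
    k 1 ^ 2 * eval a (pderiv 1 (pderiv 1 (F i)))) / 2
  let f := sub a e k β (F i)
  let g := sub a e k β (F j) - C lam * sub a e k β (F i)
  have he' : f0 * e 0 + f1 * e 1 = 1 := he
  have f10 : cf f 1 0 = 1 := by
    rw [cf_sub_one_zero]
    linear_combination he'
  have f01 : cf f 0 1 = 0 := by
    rw [cf_sub_zero_one]
    show -f1 * f0 + f0 * f1 = 0
    ring
  have f02 : cf f 0 2 = 0 := by
    have h := cf_sub_zero_two (a := a) (e := e) (k := k) (β := β) (F i)
    have h2 : (2 : ℂ) * cf f 0 2 = 0 := by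
      rw [h]
      linear_combination -2 * β * he'
    exact (mul_eq_zero.1 h2).resolve_left two_ne_zero
  have g10 : cf g 1 0 = 0 := by
    rw [cf_sub_C_mul, f10, cf_sub_one_zero]
    show e0 * g0 + e1 * g1 - (g0 * e0 + g1 * e1) * 1 = 0
    ring
  have g01 : cf g 0 1 = 0 := by
    rw [cf_sub_C_mul, f01, cf_sub_zero_one]
    show -f1 * g0 + f0 * g1 - lam * 0 = 0
    linear_combination hJ'
  have hD2 : 2 * cf g 0 2 = eval a (cuspidal F i j) := two_mul_cf_zero_two rfl hl0 hl1
  by_cases hD : eval a (cuspidal F i j) = 0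
  · right
    have h1 := hF.transversal_corank_one a
    have hdet := independent_of_transversal_second hij he
      (jet_mem_secondStratum hij hJ he h1 hD) (hF.transversal_second a)
    rw [det_eq_mul_cf (e := e) (k := k) (β := β) (lam := lam) rfl he' hl0 hl1 f02 hD] at hdet
    refine IsParametrizedBy.of_normalized hij he' rfl rfl contDiff_cuspMap.continuous cuspMap_zero
      (exists_parameters_cusp f g f10 f01 f02 g10 g01 ?_ (left_ne_zero_of_mul hdet) ?_)
    · rw [hD] at hD2
      exact (mul_eq_zero.1 hD2).resolve_left two_ne_zero
    · exact right_ne_zero_of_mul (right_ne_zero_of_mul hdet)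
  · left
    refine IsParametrizedBy.of_normalized hij he' rfl rfl contDiff_foldMap.continuous foldMap_zero
      (exists_parameters_fold f g f10 f01 f02 g10 g01 ?_)
    rw [← hD2] at hD
    exact right_ne_zero_of_mul hD
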